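/- Let $G$ be a group and $\mathcal P$ a finite collection of subgroups of $G$. A finite relative generating set of $(G,\mathcal P)$ is a finite set $S\subseteq G$ such that $S\cup\bigcup_{P\in\mathcal P}P$ generates $G$ (for instance a finite generating set of $G$). The coned-off Cayley graph $\hat\Gamma(G,\mathcal P,S)$ is the graph with vertex set $G\sqcup\{gP : g\in G,\ P\in\mathcal P\}$ (one cone vertex for each pair of $P$ and a left coset $gP$), in which $g$ is joined to $gs$ for all $g\in G$, $s\in S$ with $gs\neq g$, and each $g\in G$ is joined to the cone vertex $gP$ for each $P\in\mathcal P$; it carries the path metric on its vertices. The pair $(G,\mathcal P)$ is relatively hyperbolic if, for some finite relative generating set $S$, the graph $\hat\Gamma(G,\mathcal P,S)$ is Gromov hyperbolic and fine (each edge lies in only finitely many circuits of length $n$, for each $n$). A cellular action of $G$ by isometries on a CAT(0) cube complex $X$ is relatively geometric with respect to $\mathcal P$ if (1) the quotient $G\backslash X$ is compact; (2) each $P\in\mathcal P$ acts elliptically on $X$, i.e. fixes a point of $X$; and (3) the stabilizer in $G$ of each cell of $X$ is either finite or conjugate to a finite-index subgroup of an element of $\mathcal P$. Proposition. Suppose that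 $(G,\mathcal P)$ is relatively hyperbolic and that $G$ acts relatively geometrically with respect to $\mathcal P$ on a (nonempty) CAT(0) cube complex $X$. Then $X$, with its CAT(0) metric, is quasi-isometric to the coned-off Cayley graph $\hat\Gamma(G,\mathcal P,S)$ for every finite relative generating set $S$ of $(G,\mathcal P)$. Consequently $X$ is $\delta$-hyperbolic for some $\delta$. -/

import Mathlib

open scoped Pointwise

/-! ### Coarse geometry -/

/-- Gromov's four-point condition: the distance function `d` is `δ`-hyperbolic. -/
def IsGromovHyperbolic {α : Type*} (d : α → α → ℝ) (δ : ℝ) : Prop :=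
  ∀ x y z w : α, d x y + d z w ≤ max (d x z + d y w) (d x w + d y z) + 2 * δ

/-- `f` is a quasi-isometry from `(α, dα)` to `(β, dβ)`: a quasi-isometric embedding with
coarsely dense image. -/
def IsQuasiIsometry {α β : Type*} (dα : α → α → ℝ) (dβ : β → β → ℝ) (f : α → β) : Prop :=
  ∃ K C : ℝ, 1 ≤ K ∧ 0 ≤ C ∧
    (∀ x y : α, K⁻¹ * dα x y - C ≤ dβ (f x) (f y) ∧ dβ (f x) (f y) ≤ K * dα x y + C) ∧
    ∀ b : β, ∃ a : α, dβ (f a) b ≤ C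

/-- `(α, dα)` and `(β, dβ)` are quasi-isometric. -/
def QuasiIsometric {α β : Type*} (dα : α → α → ℝ) (dβ : β → β → ℝ) : Prop :=
  ∃ f : α → β, IsQuasiIsometry dα dβ f

/-- The path metric on the vertices of a (connected) graph, all edges having length one. -/
noncomputable def graphDist {V : Type*} (Γ : SimpleGraph V) (u v : V) : ℝ := (Γ.dist u v : ℝ)

/-- A graph is fine if every edge lies in only finitely many circuits of each given length.
The circuits through the edge `uv` are listed as closed walks based at `u`. -/
def IsFineGraph {V : Type*} (Γ : SimpleGraph V) : Prop :=
  ∀ u v : V, Γ.Adj u v → ∀ n : ℕ,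
    {c : Γ.Walk u u | c.IsCycle ∧ c.length = n ∧ s(u, v) ∈ c.edges}.Finite

/-! ### Relatively hyperbolic groups -/

section GroupPair

variable {G : Type*} [Group G]

/-- `S` is a finite relative generating set of `(G, 𝓟)`: it is finite and generates `G` together
with the subgroups in `𝓟`. -/
def IsFiniteRelGenSet (𝓟 : Set (Subgroup G)) (S : Set G) : Prop :=
  S.Finite ∧ Subgroup.closure (S ∪ ⋃ P ∈ 𝓟, (P : Set G)) = ⊤

/-- The vertices of the coned-off Cayley graph: the elements of `G`, and one cone vertex for each
left coset `gP` with `P ∈ 𝓟`. -/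
abbrev ConedOffVertex (𝓟 : Set (Subgroup G)) : Type _ :=
  G ⊕ (Σ P : 𝓟, G ⧸ (P : Subgroup G))

/-- The (generating) adjacencies of the coned-off Cayley graph: `g` is joined to `gs` for `s ∈ S`,
and every `g` is joined to the cone vertex of each coset `gP`. -/
inductive ConedOffRel (𝓟 : Set (Subgroup G)) (S : Set G) :
    ConedOffVertex 𝓟 → ConedOffVertex 𝓟 → Prop
  | cayley (g s : G) (hs : s ∈ S) : ConedOffRel 𝓟 S (Sum.inl g) (Sum.inl (g * s))
  | cone (g : G) (P : 𝓟) : ConedOffRel 𝓟 S (Sum.inl g) (Sum.inr ⟨P, (g : G ⧸ (P : Subgroup G))⟩)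

/-- The coned-off Cayley graph of `(G, 𝓟)` with respect to `S`. -/
def conedOffCayleyGraph (𝓟 : Set (Subgroup G)) (S : Set G) : SimpleGraph (ConedOffVertex 𝓟) :=
  SimpleGraph.fromRel (ConedOffRel 𝓟 S)

/-- `(G, 𝓟)` is relatively hyperbolic: `𝓟` is a finite collection of subgroups and the coned-off
Cayley graph for some finite relative generating set is Gromov hyperbolic and fine. -/
def IsRelativelyHyperbolic (𝓟 : Set (Subgroup G)) : Prop :=
  𝓟.Finite ∧ ∃ S : Set G, IsFiniteRelGenSet 𝓟 S ∧
    (∃ δ : ℝ, IsGromovHyperbolic (graphDist (conedOffCayleyGraph 𝓟 S)) δ) ∧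
    IsFineGraph (conedOffCayleyGraph 𝓟 S)

end GroupPair

/-! ### CAT(0) spaces -/

/-- `γ`, restricted to `[0, 1]`, is a geodesic from `x` to `y` parametrized proportionally to
arc length. -/
def IsGeodesicFromTo {X : Type*} [MetricSpace X] (γ : ℝ → X) (x y : X) : Prop :=
  γ 0 = x ∧ γ 1 = y ∧
    ∀ s ∈ Set.Icc (0 : ℝ) 1, ∀ t ∈ Set.Icc (0 : ℝ) 1, dist (γ s) (γ t) = |s - t| * dist x y

/-- `X` is a CAT(0) space: it is geodesic, and points on two sides of a geodesic triangle are no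
further apart than the corresponding points of a Euclidean comparison triangle. -/
def IsCAT0Space (X : Type*) [MetricSpace X] : Prop :=
  (∀ x y : X, ∃ γ : ℝ → X, IsGeodesicFromTo γ x y) ∧
  ∀ (x y z : X) (γ η : ℝ → X), IsGeodesicFromTo γ x y → IsGeodesicFromTo η x z →
    ∀ x' y' z' : EuclideanSpace ℝ (Fin 2),
      dist x' y' = dist x y → dist x' z' = dist x z → dist y' z' = dist y z →
      ∀ s ∈ Set.Icc (0 : ℝ) 1, ∀ t ∈ Set.Icc (0 : ℝ) 1,
        dist (γ s) (η t) ≤ dist (AffineMap.lineMap x' y' s) (AffineMap.lineMap x' z' t)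

/-! ### Cube complexes -/

/-- The unit cube `[0, 1]ⁿ` with its Euclidean metric. -/
def unitCube (n : ℕ) : Set (EuclideanSpace ℝ (Fin n)) := {x | ∀ i, x i ∈ Set.Icc (0 : ℝ) 1}

/-- `T` is a (nonempty) face of the unit cube: the coordinates in some set `I` are frozen, each at
`0` or `1`. -/
def IsCubeFace {n : ℕ} (T : Set (EuclideanSpace ℝ (Fin n))) : Prop :=
  ∃ (I : Set (Fin n)) (ε : Fin n → ℝ), (∀ i, ε i = 0 ∨ ε i = 1) ∧
    T = {x | x ∈ unitCube n ∧ ∀ i ∈ I, x i = ε i}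

/-- The structure of a cube complex on a set `X`: a collection of subsets (the closed cells, or
cubes), closed under passing to faces, which cover `X`, each identified with a unit cube by an
injective chart, so that any two cubes that meet are glued along an isometry of faces.
The values of `dim` and `chart` matter only on cells. -/
structure CubeComplex (X : Type*) where
  cells : Set (Set X)
  dim : Set X → ℕ
  chart : (C : Set X) → EuclideanSpace ℝ (Fin (dim C)) → X
  chart_injOn : ∀ C ∈ cells, Set.InjOn (chart C) (unitCube (dim C))
  image_chart : ∀ C ∈ cells, chart C '' unitCube (dim C) = C
  cover : ∀ x : X, ∃ C ∈ cells, x ∈ C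
  face_mem : ∀ C ∈ cells, ∀ T : Set (EuclideanSpace ℝ (Fin (dim C))), IsCubeFace T →
    chart C '' T ∈ cells
  glue : ∀ C ∈ cells, ∀ D ∈ cells, (C ∩ D).Nonempty →
    ∃ (T : Set (EuclideanSpace ℝ (Fin (dim C)))) (T' : Set (EuclideanSpace ℝ (Fin (dim D))))
      (h : EuclideanSpace ℝ (Fin (dim C)) → EuclideanSpace ℝ (Fin (dim D))),
      IsCubeFace T ∧ IsCubeFace T' ∧ Set.BijOn h T T' ∧
      (∀ x ∈ T, ∀ y ∈ T, dist (h x) (h y) = dist x y) ∧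
      ∀ x ∈ unitCube (dim C), ∀ y ∈ unitCube (dim D),
        chart C x = chart D y ↔ x ∈ T ∧ h x = y

namespace CubeComplex

variable {X : Type*}

/-- `K.StringLength x y L`: there is a string from `x` to `y`, that is, a finite sequence of points
in which any two consecutive ones are chosen in a common cube, of total Euclidean length `L`. -/
inductive StringLength (K : CubeComplex X) : X → X → ℝ → Prop
  | nil (x : X) : StringLength K x x 0
  | cons {C : Set X} (hC : C ∈ K.cells) {p q : EuclideanSpace ℝ (Fin (K.dim C))}
      (hp : p ∈ unitCube (K.dim C)) (hq : q ∈ unitCube (K.dim C)) {z : X} {L : ℝ}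
      (h : StringLength K (K.chart C q) z L) : StringLength K (K.chart C p) z (dist p q + L)

/-- `K` is a CAT(0) cube complex: the metric of `X` is the length metric of the cube complex
(the distance is the infimum of the lengths of strings, and any two points are joined by a string),
and it is CAT(0). -/
structure IsCAT0 [MetricSpace X] (K : CubeComplex X) : Prop where
  isGLB_dist : ∀ x y : X, IsGLB {L : ℝ | K.StringLength x y L} (dist x y)
  isCAT0Space : IsCAT0Space X

/-- An action of `G` by isometries on a cube complex is relatively geometric with respect to `𝓟`:
it is cellular and cocompact, every `P ∈ 𝓟` is elliptic (fixes a point), and the stabilizer of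
each cell is finite or conjugate to a finite-index subgroup of some `P ∈ 𝓟`. -/
structure IsRelativelyGeometric {G : Type*} [Group G] [MetricSpace X] [MulAction G X]
    [IsIsometricSMul G X] (K : CubeComplex X) (𝓟 : Set (Subgroup G)) : Prop where
  cellular : ∀ g : G, ∀ C ∈ K.cells, g • C ∈ K.cells
  cocompact : CompactSpace (MulAction.orbitRel.Quotient G X)
  elliptic : ∀ P ∈ 𝓟, ∃ x : X, ∀ g ∈ P, g • x = x
  stabilizer : ∀ C ∈ K.cells, Finite (MulAction.stabilizer G C) ∨
    ∃ P ∈ 𝓟, ∃ Q : Subgroup G, Q ≤ P ∧ Q.relIndex P ≠ 0 ∧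
      ∃ g : G, MulAction.stabilizer G C = MulAut.conj g • Q

end CubeComplex

/-! The quasi-isometry is a Milnor–Švarc argument in which the word metric is replaced by the
coned-off metric `d` restricted to `G`. The orbit map is Lipschitz for `d` because it extends over
the cone vertices: send `gP` to `g` times a point fixed by `P`
(`exists_dist_smul_le_mul_graphDist`).

For a coarse inverse, pick a cell through each point of `X` and a group element carrying the chosen
representative of its orbit onto it (`exists_coarse_inverse_orbit_map`). This element is ambiguous
up to a cell stabilizer, which is `d`-bounded: it is finite or lies in a conjugate of some `P`, and
any two elements of a coset of `P` are at distance at most 2. Since `X` need not be locally finite,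
cocompactness is exploited through cores: all cells meeting a small ball about `x` contain one fixed
cell (`exists_isCore`). Hence there are finitely many orbits of cells, and a Lebesgue number below
which cells through two points share a subcell. Cutting a geodesic of `X` into steps of that size
gives the coarse Lipschitz bound.

For hyperbolicity, geodesics of `X` map to quasi-geodesics of a hyperbolic graph, and graph
geodesics stay close to these (`exists_geodesic_near_quasigeodesic`). So being almost between two
points passes from the graph back to `X`, and the four-point condition follows by examining a coarse
centre of three of the points. -/

/-! ### Faces of the unit cube -/

theorem IsCubeFace.subset_unitCube {n : ℕ} {T : Set (EuclideanSpace ℝ (Fin n))}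
    (hT : IsCubeFace T) : T ⊆ unitCube n := by
  obtain ⟨I, ε, -, rfl⟩ := hT
  exact fun x hx => hx.1

theorem finite_setOf_isCubeFace (n : ℕ) :
    {T : Set (EuclideanSpace ℝ (Fin n)) | IsCubeFace T}.Finite := by
  have hε : {ε : Fin n → ℝ | ∀ i, ε i ∈ ({0, 1} : Set ℝ)}.Finite :=
    (Set.Finite.pi (fun _ : Fin n => (Set.toFinite ({0, 1} : Set ℝ)))).subset
      fun ε h => by simpa [Set.mem_pi] using h
  refine ((Set.finite_univ (α := Set (Fin n))).image2
    (fun I ε => {x : EuclideanSpace ℝ (Fin n) | x ∈ unitCube n ∧ ∀ i ∈ I, x i = ε i}) hε).subset ?_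
  rintro T ⟨I, ε, h, rfl⟩
  exact ⟨I, Set.mem_univ _, ε, h, rfl⟩

theorem EuclideanSpace.abs_sub_apply_le_dist {n : ℕ} (x y : EuclideanSpace ℝ (Fin n)) (i : Fin n) :
    |x i - y i| ≤ dist x y := by
  rw [dist_eq_norm]
  simpa using PiLp.norm_apply_le (x - y) i

theorem center_mem_unitCube (n : ℕ) :
    (WithLp.toLp 2 fun _ => (1 / 2 : ℝ) : EuclideanSpace ℝ (Fin n)) ∈ unitCube n := by
  intro i
  constructor <;> norm_num

theorem dist_le_of_mem_unitCube {n : ℕ} {x y : EuclideanSpace ℝ (Fin n)} (hx : x ∈ unitCube n)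
    (hy : y ∈ unitCube n) : dist x y ≤ √n := by
  rw [EuclideanSpace.dist_eq]
  apply Real.sqrt_le_sqrt
  calc ∑ i, dist (x i) (y i) ^ 2 ≤ ∑ _i : Fin n, (1 : ℝ) := by
        refine Finset.sum_le_sum fun i _ => ?_
        rw [Real.dist_eq, sq_abs]
        have h1 := hx i
        have h2 := hy i
        nlinarith [h1.1, h1.2, h2.1, h2.2]
    _ = n := by simp

/-- A distance-preserving map defined on the whole cube, onto a face of another cube: a face of the
target cube which comes closer to the image of `p` than the boundary of the source is to `p`
contains the image of `p`. -/
theorem apply_eq_of_dist_lt {m n : ℕ} {h : EuclideanSpace ℝ (Fin m) → EuclideanSpace ℝ (Fin n)}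
    {T' : Set (EuclideanSpace ℝ (Fin n))} (hT' : IsCubeFace T')
    (hbij : Set.BijOn h (unitCube m) T')
    (hdist : ∀ x ∈ unitCube m, ∀ y ∈ unitCube m, dist (h x) (h y) = dist x y)
    {p : EuclideanSpace ℝ (Fin m)} {r : ℝ} (hr1 : r ≤ 1)
    (hp : ∀ i, r ≤ p i ∧ p i ≤ 1 - r) (hpc : p ∈ unitCube m)
    {q' : EuclideanSpace ℝ (Fin n)} (hq' : dist (h p) q' < r)
    {i : Fin n} {e : ℝ} (he : e = 0 ∨ e = 1) (hi : q' i = e) : h p i = e := by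
  have hqT : h p ∈ T' := hbij.mapsTo hpc
  by_contra hne
  have hcoord := EuclideanSpace.abs_sub_apply_le_dist (h p) q' i
  rw [hi] at hcoord
  obtain ⟨J, ε, hε, rfl⟩ := hT'
  -- If coordinate `i` is frozen on `T'`, both values are 0 or 1, so distinct values would put `q'`
  -- at distance at least `1 ≥ r`.
  by_cases hiJ : i ∈ J
  · have h1 := hqT.2 i hiJ
    rw [h1] at hcoord hne
    rcases hε i with h0 | h0 <;> rcases he with h2 | h2 <;> rw [h0, h2] at hcoord hne
    · exact hne rfl
    · norm_num at hcoord; linarith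
    · norm_num at hcoord; linarith
    · exact hne rfl
  -- replace the `i`-th coordinate
  set q'' : EuclideanSpace ℝ (Fin n) := WithLp.toLp 2 (Function.update (h p) i e) with hq''
  have hq''i : q'' i = e := by simp [hq'']
  have hq''j : ∀ j, j ≠ i → q'' j = h p j := fun j hj => by simp [hq'', hj]
  have hq''T : q'' ∈ {x | x ∈ unitCube n ∧ ∀ i ∈ J, x i = ε i} := by
    refine ⟨fun j => ?_, fun j hj => ?_⟩
    · by_cases hji : j = i
      · subst hji
        rw [hq''i]
        rcases he with rfl | rfl <;> norm_num
      · rw [hq''j j hji]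
        exact hqT.1 j
    · rw [hq''j j (fun hji => hiJ (hji ▸ hj))]
      exact hqT.2 j hj
  have hd : dist (h p) q'' = |h p i - e| := by
    rw [EuclideanSpace.dist_eq, Finset.sum_eq_single i]
    · rw [hq''i, Real.sqrt_sq dist_nonneg, Real.dist_eq]
    · intro j _ hj
      rw [hq''j j hj]
      simp
    · simp
  obtain ⟨p'', hp'', hhp''⟩ := hbij.surjOn hq''T
  set ρ := dist p p'' with hρ
  have hρ' : ρ = |h p i - e| := by rw [hρ, ← hdist p hpc p'' hp'', hhp'', hd]
  have hρ0 : 0 < ρ := by rw [hρ']; exact abs_pos.2 (sub_ne_zero.2 hne)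
  have hρr : ρ < r := by rw [hρ']; linarith
  -- Prolong the segment from `p` to `p''` up to length `r`, which keeps it in the source cube. Its
  -- image is again a segment, by equality in the triangle inequality, and crosses the wall `x i =
  -- e` before its end; this would push `h p₃` out of the target cube.
  set p₃ := AffineMap.lineMap p p'' (r / ρ) with hp₃
  have hone : 1 < r / ρ := by rw [one_lt_div hρ0]; exact hρr
  have hpp₃ : dist p p₃ = r := by
    rw [hp₃, dist_left_lineMap, Real.norm_of_nonneg (by linarith), ← hρ]
    field_simp
  have hp₃c : p₃ ∈ unitCube m := by
    intro j
    have h1 := EuclideanSpace.abs_sub_apply_le_dist p p₃ j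
    rw [hpp₃, abs_le] at h1
    have h2 := hp j
    constructor <;> linarith [h1.1, h1.2, h2.1, h2.2]
  have hw : Wbtw ℝ p p'' p₃ := by
    refine ⟨ρ / r, ⟨div_nonneg hρ0.le (by linarith), (div_le_one (by linarith)).2 hρr.le⟩, ?_⟩
    rw [hp₃, AffineMap.lineMap_lineMap_right]
    have : ρ / r * (r / ρ) = 1 := by
      have : r ≠ 0 := by linarith
      field_simp
    rw [this, AffineMap.lineMap_apply_one]
  have hw' : Wbtw ℝ (h p) (h p'') (h p₃) := by
    rw [← dist_add_dist_eq_iff, hdist _ hpc _ hp'', hdist _ hp'' _ hp₃c, hdist _ hpc _ hp₃c]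
    exact dist_add_dist_eq_iff.2 hw
  obtain ⟨t, ht, hte⟩ := hw'
  have hρt : ρ = t * r := by
    have h1 : dist (h p) (h p'') = ρ := hdist _ hpc _ hp''
    rw [← hte, dist_left_lineMap, Real.norm_of_nonneg ht.1, hdist _ hpc _ hp₃c, hpp₃] at h1
    exact h1.symm
  have ht1 : t < 1 := by
    by_contra hcon
    have : t = 1 := le_antisymm ht.2 (not_lt.1 hcon)
    rw [this] at hρt
    linarith
  have hcoord2 : (1 - t) * h p i + t * h p₃ i = e := by
    have h1 : AffineMap.lineMap (h p) (h p₃) t i = q'' i := by rw [hte, hhp'']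
    rw [hq''i, AffineMap.lineMap_apply_module] at h1
    simpa using h1
  have h3 := (hbij.mapsTo hp₃c).1 i
  have h4 := hqT.1 i
  rcases he with rfl | rfl
  · apply hne
    have h5 : 0 ≤ t * h p₃ i := mul_nonneg ht.1 h3.1
    have h6 : (1 - t) * h p i ≤ 0 := by linarith
    have h7 : h p i ≤ 0 := by
      by_contra hcon
      nlinarith [mul_pos (sub_pos.2 ht1) (not_le.1 hcon)]
    exact le_antisymm h7 h4.1
  · apply hne
    have h5 : t * h p₃ i ≤ t := by nlinarith [ht.1, h3.2]
    have h7 : 1 ≤ h p i := by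
      by_contra hcon
      nlinarith [mul_pos (sub_pos.2 ht1) (sub_pos.2 (not_le.1 hcon))]
    exact le_antisymm h4.2 h7

/-! ### Local structure of cube complexes -/

namespace CubeComplex

variable {X : Type*} (K : CubeComplex X)

theorem chart_mem {C : Set X} (hC : C ∈ K.cells) {x : EuclideanSpace ℝ (Fin (K.dim C))}
    (hx : x ∈ unitCube (K.dim C)) : K.chart C x ∈ C := by
  have := Set.mem_image_of_mem (K.chart C) hx
  rwa [K.image_chart C hC] at this

theorem exists_inter_eq_image_face {C D : Set X} (hC : C ∈ K.cells) (hD : D ∈ K.cells)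
    (h : (C ∩ D).Nonempty) : ∃ T, IsCubeFace T ∧ C ∩ D = K.chart C '' T := by
  obtain ⟨T, T', φ, hT, hT', hbij, -, hg⟩ := K.glue C hC D hD h
  refine ⟨T, hT, Set.ext fun z => ⟨?_, ?_⟩⟩
  · rintro ⟨hzC, hzD⟩
    rw [← K.image_chart C hC] at hzC
    rw [← K.image_chart D hD] at hzD
    obtain ⟨x, hx, rfl⟩ := hzC
    obtain ⟨y, hy, hxy⟩ := hzD
    exact ⟨x, ((hg x hx y hy).1 hxy.symm).1, rfl⟩
  · rintro ⟨x, hx, rfl⟩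
    have hy := hT'.subset_unitCube (hbij.mapsTo hx)
    have := (hg x (hT.subset_unitCube hx) _ hy).2 ⟨hx, rfl⟩
    exact ⟨K.chart_mem hC (hT.subset_unitCube hx), this ▸ K.chart_mem hD hy⟩

theorem nonempty_of_mem_cells {C : Set X} (hC : C ∈ K.cells) : C.Nonempty := by
  rw [← K.image_chart C hC]
  exact ⟨_, _, center_mem_unitCube _, rfl⟩

/-- A cell inside `C` is its own intersection with `C`, hence the image of a face by the gluing
axiom. -/
theorem finite_subcells {C : Set X} (hC : C ∈ K.cells) : {D ∈ K.cells | D ⊆ C}.Finite := by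
  refine ((finite_setOf_isCubeFace (K.dim C)).image (fun T => K.chart C '' T)).subset ?_
  rintro D ⟨hD, hDC⟩
  have hCD : C ∩ D = D := Set.inter_eq_self_of_subset_right hDC
  obtain ⟨T, hT, he⟩ := K.exists_inter_eq_image_face hC hD
    (by rw [hCD]; exact K.nonempty_of_mem_cells hD)
  exact ⟨T, hT, he.symm.trans hCD⟩

/-- Every cell which comes closer to `x` than `r` contains `C`. -/
def IsCore [MetricSpace X] (x : X) (C : Set X) (r : ℝ) : Prop :=
  ∀ y : X, dist x y < r → ∀ D ∈ K.cells, y ∈ D → C ⊆ D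

variable {K}

theorem isCubeFace_eq_unitCube_of_interior {n : ℕ} {T : Set (EuclideanSpace ℝ (Fin n))} (hT : IsCubeFace T)
    {p : EuclideanSpace ℝ (Fin n)} (hp : ∀ i, 0 < p i ∧ p i < 1) (hpT : p ∈ T) :
    T = unitCube n := by
  obtain ⟨I, ε, hε, rfl⟩ := hT
  refine Set.ext fun x => ⟨fun hx => hx.1, fun hx => ⟨hx, fun i hi => ?_⟩⟩
  have h1 := hpT.2 i hi
  have h2 := hp i
  rcases hε i with h0 | h0 <;> rw [h0] at h1 <;> linarith [h2.1, h2.2]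

/-- Cells through an interior point of a cell `C` contain `C`, and their faces which come close to
this point contain it. -/
theorem subset_and_mem_face_of_interior {C D : Set X} (hC : C ∈ K.cells) (hD : D ∈ K.cells)
    {r : ℝ} (hr : 0 < r) (hr1 : r ≤ 1) {p : EuclideanSpace ℝ (Fin (K.dim C))}
    (hpc : p ∈ unitCube (K.dim C)) (hp : ∀ i, r ≤ p i ∧ p i ≤ 1 - r)
    {q : EuclideanSpace ℝ (Fin (K.dim D))} (hq : q ∈ unitCube (K.dim D))
    (hpq : K.chart C p = K.chart D q) :
    C ⊆ D ∧ ∀ T, IsCubeFace T → ∀ q' ∈ T, dist q q' < r → q ∈ T := by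
  obtain ⟨T, T', φ, hT, hT', hbij, hdist, hg⟩ := K.glue C hC D hD
    ⟨K.chart C p, K.chart_mem hC hpc, hpq ▸ K.chart_mem hD hq⟩
  obtain ⟨hpT, hφ⟩ := (hg p hpc q hq).1 hpq
  obtain rfl := isCubeFace_eq_unitCube_of_interior hT
    (fun i => ⟨by linarith [(hp i).1], by linarith [(hp i).2]⟩) hpT
  constructor
  · intro z hz
    rw [← K.image_chart C hC] at hz
    obtain ⟨x, hx, rfl⟩ := hz
    have hy := hT'.subset_unitCube (hbij.mapsTo hx)
    rw [(hg x hx _ hy).2 ⟨hx, rfl⟩]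
    exact K.chart_mem hD hy
  · rintro F ⟨I, ε, hε, rfl⟩ q' hq' hlt
    subst hφ
    exact ⟨hq, fun i hi => apply_eq_of_dist_lt hT' hbij hdist hr1 hp hpc hlt (hε i) (hq'.2 i hi)⟩

theorem isCore_of_interior [MetricSpace X] (hK : K.IsCAT0) {C : Set X} (hC : C ∈ K.cells)
    {r : ℝ} (hr : 0 < r) (hr1 : r ≤ 1) {p : EuclideanSpace ℝ (Fin (K.dim C))}
    (hpc : p ∈ unitCube (K.dim C)) (hp : ∀ i, r ≤ p i ∧ p i ≤ 1 - r) :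
    K.IsCore (K.chart C p) C r := by
  -- points near `chart C p` lie in a common cell with it, at a distance read off in any such cell
  let N : X → ℝ → Prop := fun y s => ∀ E ∈ K.cells, y ∈ E →
    ∃ a ∈ unitCube (K.dim E), ∃ b ∈ unitCube (K.dim E),
      K.chart E a = K.chart C p ∧ K.chart E b = y ∧ dist a b ≤ s
  -- One cell suffices to read off the distance: `D ∩ E` is a face coming within `r` of the centre
  -- point, so it contains that point, and the gluing map of `D` with `E` preserves distances on it.
  have transfer : ∀ D ∈ K.cells, ∀ a ∈ unitCube (K.dim D), ∀ b ∈ unitCube (K.dim D),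
      K.chart D a = K.chart C p → ∀ s, dist a b ≤ s → s < r → N (K.chart D b) s := by
    intro D hD a ha b hb hax s hs hsr E hE hyE
    have hyD : K.chart D b ∈ D := K.chart_mem hD hb
    obtain ⟨T, T', φ, hT, hT', hbij, hdist, hg⟩ := K.glue D hD E hE ⟨_, hyD, hyE⟩
    rw [← K.image_chart E hE] at hyE
    obtain ⟨b', hb', hbb'⟩ := hyE
    obtain ⟨hbT, hφ⟩ := (hg b hb b' hb').1 hbb'.symm
    have haT : a ∈ T := (subset_and_mem_face_of_interior hC hD hr hr1 hpc hp ha hax.symm).2 T hT b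
      hbT (lt_of_le_of_lt hs hsr)
    have ha' := hT'.subset_unitCube (hbij.mapsTo haT)
    refine ⟨φ a, ha', b', hb', ?_, hbb', ?_⟩
    · rw [← hax]
      exact ((hg a ha _ ha').2 ⟨haT, rfl⟩).symm
    · rw [← hφ, hdist a haT b hbT]
      exact hs
  -- A string of total length below `r` never leaves the cells that contain the centre point.
  have key : ∀ {y z L}, K.StringLength y z L → 0 ≤ L ∧ ∀ s, N y s → s + L < r → N z (s + L) := by
    intro y z L h
    induction h with
    | nil y => exact ⟨le_rfl, fun s hs _ => by simpa using hs⟩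
    | @cons D hD a b ha hb z L h ih =>
      refine ⟨add_nonneg dist_nonneg ih.1, fun s hs hlt => ?_⟩
      have haD : K.chart D a ∈ D := K.chart_mem hD ha
      obtain ⟨x', hx', a', ha', hxx', haa', hd⟩ := hs D hD haD
      obtain rfl := K.chart_injOn D hD ha' ha haa'
      rw [← add_assoc] at hlt ⊢
      refine ih.2 _ (transfer D hD x' hx' b hb hxx' _ ?_ (by linarith [ih.1])) hlt
      linarith [dist_triangle x' a' b]
  intro y hy D hD hyD
  obtain ⟨L, hL, hLr⟩ : ∃ L, K.StringLength (K.chart C p) y L ∧ L < r := by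
    by_contra! hcon
    exact absurd ((hK.isGLB_dist _ y).2 (fun L hL => hcon L hL)) (not_le.2 hy)
  have h0 : N (K.chart C p) 0 := transfer C hC p hpc p hpc rfl 0 (by simp) hr
  obtain ⟨a, ha, b, hb, hax, -, -⟩ := (key hL).2 0 h0 (by simpa using hLr) D hD hyD
  exact (subset_and_mem_face_of_interior hC hD hr hr1 hpc hp ha hax.symm).1

theorem exists_isCore_of_mem_cells [MetricSpace X] (hK : K.IsCAT0) {C : Set X} (hC : C ∈ K.cells) :
    ∃ x ∈ C, K.IsCore x C (1 / 2) := by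
  refine ⟨_, K.chart_mem hC (center_mem_unitCube _), isCore_of_interior hK hC
    (r := 1 / 2) (by norm_num) (by norm_num) (center_mem_unitCube _) (fun i => ?_)⟩
  constructor <;> norm_num

theorem exists_isCore [MetricSpace X] (hK : K.IsCAT0) (x : X) :
    ∃ C ∈ K.cells, ∃ r > 0, K.IsCore x C r := by
  obtain ⟨D, hD, hxD⟩ := K.cover x
  -- In a smallest cell through `x`, the point `x` is interior: otherwise a proper face, which
  -- misses the centre of the cube, would be a smaller cell through `x`.
  obtain ⟨C, ⟨⟨hC, hCD⟩, hxC⟩, hmin⟩ :=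
    ((K.finite_subcells hD).inter_of_left {C | x ∈ C}).exists_minimal
    ⟨D, ⟨hD, subset_rfl⟩, hxD⟩
  have hxC' : x ∈ C := hxC
  rw [← K.image_chart C hC] at hxC'
  obtain ⟨p, hp, rfl⟩ := hxC'
  have hint : ∀ i, 0 < p i ∧ p i < 1 := by
    by_contra! hcon
    obtain ⟨i, hi⟩ := hcon
    have hpi : p i = 0 ∨ p i = 1 := by
      rcases (hp i).1.eq_or_lt with h | h
      · exact Or.inl h.symm
      · exact Or.inr (le_antisymm (hp i).2 (hi h))
    let T : Set (EuclideanSpace ℝ (Fin (K.dim C))) :=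
      {y | y ∈ unitCube (K.dim C) ∧ ∀ j ∈ ({i} : Set (Fin (K.dim C))), y j = (fun _ => p i) j}
    have hT : IsCubeFace T := ⟨{i}, fun _ => p i, fun _ => hpi, rfl⟩
    have hTC : K.chart C '' T ⊆ C := by
      conv_rhs => rw [← K.image_chart C hC]
      exact Set.image_mono hT.subset_unitCube
    have hle := hmin ⟨⟨K.face_mem C hC T hT, hTC.trans hCD⟩, p, ⟨hp, by simp⟩, rfl⟩ hTC
    have hcC : K.chart C (WithLp.toLp 2 fun _ => (1 / 2 : ℝ)) ∈ C :=
      K.chart_mem hC (center_mem_unitCube _)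
    obtain ⟨y, hy, hyc⟩ := hle hcC
    obtain rfl := K.chart_injOn C hC hy.1 (center_mem_unitCube _) hyc
    have h1 := hy.2 i rfl
    simp only at h1
    rcases hpi with h | h <;> rw [h] at h1 <;> norm_num at h1
  have hev : ∀ᶠ r in nhdsWithin (0 : ℝ) (Set.Ioi 0), r ≤ 1 ∧ ∀ i, r ≤ p i ∧ p i ≤ 1 - r := by
    have hlt : ∀ a : ℝ, 0 < a → ∀ᶠ r in nhdsWithin (0 : ℝ) (Set.Ioi 0), r ≤ a := fun a ha =>
      nhdsWithin_le_nhds ((eventually_lt_nhds ha).mono fun _ h => le_of_lt h)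
    refine (hlt 1 one_pos).and (Filter.eventually_all.2 fun i => ?_)
    filter_upwards [hlt _ (hint i).1, hlt (1 - p i) (by linarith [(hint i).2])] with r h1 h2
    exact ⟨h1, by linarith⟩
  obtain ⟨r, ⟨hr1, hr⟩, hr0⟩ := (hev.and self_mem_nhdsWithin).exists
  exact ⟨C, hC, r, hr0, isCore_of_interior hK hC hr0 hr1 hp hr⟩

end CubeComplex

/-! ### Cocompact actions on cube complexes -/

theorem Set.Finite.exists_uniform_bound {α : Type*} {S : Set α} (hS : S.Finite)
    {p : α → ℝ → Prop} (hp : ∀ a ∈ S, ∃ B, p a B) (hmono : ∀ a B B', B ≤ B' → p a B → p a B') :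
    ∃ B, 0 ≤ B ∧ ∀ a ∈ S, p a B := by
  choose! b hb using hp
  obtain ⟨B, hB⟩ := (hS.image b).bddAbove
  exact ⟨max B 0, le_max_right _ _, fun a ha =>
    hmono a _ _ ((hB (Set.mem_image_of_mem b ha)).trans (le_max_left _ _)) (hb a ha)⟩

/-- The quotient map of a group action by isometries is open, so the images of the balls form an
open cover of the compact quotient. -/
theorem MulAction.exists_finset_forall_dist_smul_lt (G : Type*) {X : Type*} [Group G]
    [MetricSpace X] [MulAction G X] [IsIsometricSMul G X]
    [CompactSpace (MulAction.orbitRel.Quotient G X)] (r : X → ℝ) (hr : ∀ x, 0 < r x) :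
    ∃ F : Finset X, ∀ y, ∃ x ∈ F, ∃ g : G, dist x (g • y) < r x := by
  let π : X → MulAction.orbitRel.Quotient G X := Quotient.mk _
  obtain ⟨F, hF⟩ := (isCompact_univ (X := MulAction.orbitRel.Quotient G X)).elim_finite_subcover
    (fun x => π '' Metric.ball x (r x))
    (fun x => isOpenMap_quotient_mk'_mul _ Metric.isOpen_ball)
    (fun z _ => by
      obtain ⟨x, rfl⟩ := Quotient.exists_rep z
      exact Set.mem_iUnion.2 ⟨x, x, Metric.mem_ball_self (hr x), rfl⟩)
  refine ⟨F, fun y => ?_⟩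
  obtain ⟨x, hx, z, hz, hzy⟩ := Set.mem_iUnion₂.1 (hF (Set.mem_univ (π y)))
  obtain ⟨g, rfl⟩ : z ∈ MulAction.orbit G y := MulAction.orbitRel_apply.1 (Quotient.exact hzy)
  exact ⟨x, hx, g, by rw [dist_comm]; exact hz⟩

namespace CubeComplex

section OrbitRep

variable {G X : Type*} [Group G] [MulAction G X]

/-- The chosen representative of the orbit of a set. -/
noncomputable def orbitRep (G : Type*) {X : Type*} [Group G] [MulAction G X] (C : Set X) : Set X :=
  (Quotient.mk (MulAction.orbitRel G (Set X)) C).out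

theorem orbitRep_mem_orbit (C : Set X) : ∃ g : G, g • orbitRep G C = C := by
  have h : MulAction.orbitRel G (Set X) C (orbitRep G C) :=
    Quotient.exact (Quotient.out_eq (Quotient.mk (MulAction.orbitRel G (Set X)) C)).symm
  obtain ⟨g, hg⟩ := MulAction.orbitRel_apply.1 h
  exact ⟨g, hg⟩

theorem orbitRep_smul (g : G) (C : Set X) : orbitRep G (g • C) = orbitRep G C := by
  unfold orbitRep
  congr 1
  exact Quotient.sound (MulAction.orbitRel_apply.2 ⟨g, rfl⟩)

variable (G) in
/-- A group element moving the chosen orbit representative to the given set. -/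
noncomputable def orbitMover (C : Set X) : G := (orbitRep_mem_orbit (G := G) C).choose

theorem orbitMover_smul (C : Set X) : orbitMover G C • orbitRep G C = C :=
  (orbitRep_mem_orbit (G := G) C).choose_spec

theorem orbitRep_mem_cells {K : CubeComplex X}
    (hcell : ∀ g : G, ∀ C ∈ K.cells, g • C ∈ K.cells) {C : Set X}
    (hC : C ∈ K.cells) : orbitRep G C ∈ K.cells := by
  have := hcell (orbitMover G C)⁻¹ C hC
  rwa [← eq_inv_smul_iff.2 (orbitMover_smul (G := G) C)] at this

end OrbitRep

variable {G X : Type*} [Group G] [MetricSpace X] {K : CubeComplex X} [MulAction G X]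

theorem IsCore.smul [IsIsometricSMul G X]
    (hcell : ∀ g : G, ∀ C ∈ K.cells, g • C ∈ K.cells) {x : X} {C : Set X} {r : ℝ}
    (h : K.IsCore x C r) (g : G) : K.IsCore (g • x) (g • C) r := by
  intro y hy D hD hyD
  rw [Set.smul_set_subset_iff_subset_inv_smul_set]
  refine h (g⁻¹ • y) ?_ _ (hcell _ _ hD) (Set.smul_mem_smul_set hyD)
  rwa [← dist_smul g, smul_inv_smul]

/-- Centres of cells have cores of uniform radius 1/2, while finitely many balls of radius 1/4 cover
`X` up to translation. Two cells whose centres can be moved into the same ball contain each other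
after translation, so they lie in one orbit. -/
theorem finite_orbitRep [IsIsometricSMul G X] (hK : K.IsCAT0)
    (hcell : ∀ g : G, ∀ C ∈ K.cells, g • C ∈ K.cells)
    [CompactSpace (MulAction.orbitRel.Quotient G X)] : (orbitRep G '' K.cells).Finite := by
  obtain ⟨F, hF⟩ := MulAction.exists_finset_forall_dist_smul_lt G (fun _ : X => (1 / 4 : ℝ))
    (fun _ => by norm_num)
  rcases isEmpty_or_nonempty X with hX | hX
  · exact Set.toFinite _
  choose! c hcC hc using fun C (hC : C ∈ K.cells) => exists_isCore_of_mem_cells hK hC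
  choose b hbF g hg using fun C : Set X => hF (c C)
  refine Set.Finite.of_finite_image (f := fun R => b R) (F.finite_toSet.subset ?_) ?_
  · rintro _ ⟨R, -, rfl⟩
    exact hbF R
  · rintro _ ⟨C', hC', rfl⟩ _ ⟨D', hD', rfl⟩ hCD
    obtain ⟨C, hC, hCC⟩ : ∃ C ∈ K.cells, orbitRep G C' = C :=
      ⟨_, orbitRep_mem_cells hcell hC', rfl⟩
    obtain ⟨D, hD, hDD⟩ : ∃ D ∈ K.cells, orbitRep G D' = D :=
      ⟨_, orbitRep_mem_cells hcell hD', rfl⟩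
    simp only [hCC, hDD] at hCD ⊢
    have hd : dist (g C • c C) (g D • c D) < 1 / 2 := by
      have h1 := hg C
      have h2 := hg D
      rw [← hCD] at h2
      linarith [dist_triangle_left (g C • c C) (g D • c D) (b C)]
    have h1 : g C • C ⊆ g D • D := (hc C hC).smul hcell (g C) _ hd _ (hcell _ _ hD)
      (Set.smul_mem_smul_set (hcC D hD))
    rw [dist_comm] at hd
    have h2 : g D • D ⊆ g C • C := (hc D hD).smul hcell (g D) _ hd _ (hcell _ _ hC)
      (Set.smul_mem_smul_set (hcC C hC))
    have h3 : orbitRep G C = orbitRep G D := by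
      rw [← orbitRep_smul (g C) C, h1.antisymm h2, orbitRep_smul]
    have h4 : ∀ E : Set X, orbitRep G (orbitRep G E) = orbitRep G E := fun E => by
      conv_rhs => rw [← orbitMover_smul (G := G) E, orbitRep_smul]
    rw [← hCC, ← hDD, ← h4 C', ← h4 D', hCC, hDD, h3]

/-- Finitely many balls of half the core radius cover `X` up to translation. If `ε` is below all
these half radii, both points fall in one core ball, and the core translated back is the common
subcell. -/
theorem exists_lebesgue_number [IsIsometricSMul G X] (hK : K.IsCAT0)
    (hcell : ∀ g : G, ∀ C ∈ K.cells, g • C ∈ K.cells)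
    [CompactSpace (MulAction.orbitRel.Quotient G X)] :
    ∃ ε > 0, ∀ y z, dist y z < ε → ∀ C ∈ K.cells, ∀ D ∈ K.cells, y ∈ C → z ∈ D →
      ∃ E ∈ K.cells, E ⊆ C ∧ E ⊆ D := by
  choose c hcK r hr hc using fun x : X => exists_isCore hK x
  obtain ⟨F, hF⟩ := MulAction.exists_finset_forall_dist_smul_lt G (fun x => r x / 2)
    (fun x => half_pos (hr x))
  have hev : ∀ᶠ ε in nhdsWithin (0 : ℝ) (Set.Ioi 0), ∀ x ∈ F, ε < r x / 2 :=
    (Filter.eventually_all_finset F).2 fun x _ =>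
      nhdsWithin_le_nhds (eventually_lt_nhds (half_pos (hr x)))
  obtain ⟨ε, hε, hε0⟩ := (hev.and self_mem_nhdsWithin).exists
  refine ⟨ε, hε0, fun y z hyz C hC D hD hy hz => ?_⟩
  obtain ⟨x, hx, g, hg⟩ := hF y
  have h1 : c x ⊆ g • C := hc x _ (by linarith [hr x]) _ (hcell g C hC) (Set.smul_mem_smul_set hy)
  have h2 : c x ⊆ g • D := by
    refine hc x (g • z) ?_ _ (hcell g D hD) (Set.smul_mem_smul_set hz)
    have h3 := dist_triangle x (g • y) (g • z)
    rw [dist_smul] at h3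
    linarith [hε x hx]
  refine ⟨g⁻¹ • c x, hcell _ _ (hcK x), ?_, ?_⟩
  · rwa [Set.smul_set_subset_iff_subset_inv_smul_set, inv_inv]
  · rwa [Set.smul_set_subset_iff_subset_inv_smul_set, inv_inv]

/-! ### A coarse inverse of the orbit map. -/

theorem exists_forall_mem_cell_dist_le (hK : K.IsCAT0) {C : Set X} (hC : C ∈ K.cells) (x₀ : X) :
    ∃ B, ∀ x ∈ C, dist x x₀ ≤ B := by
  obtain ⟨y, hy⟩ := K.nonempty_of_mem_cells hC
  refine ⟨√(K.dim C) + dist y x₀, fun x hx => (dist_triangle x y x₀).trans ?_⟩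
  rw [← K.image_chart C hC] at hx hy
  obtain ⟨p, hp, rfl⟩ := hx
  obtain ⟨q, hq, rfl⟩ := hy
  have h1 : K.StringLength (K.chart C p) (K.chart C q) (dist p q + 0) :=
    .cons hC hp hq (.nil _)
  have h2 := (hK.isGLB_dist (K.chart C p) (K.chart C q)).1 h1
  linarith [dist_le_of_mem_unitCube hp hq]

/-- Let `d` be a left-invariant pseudometric on `G` for which the stabilizers of cells are bounded.
Then `X` maps to `(G, d)` in a coarsely Lipschitz way, by a coarse inverse of an orbit map. -/
theorem exists_coarse_inverse_orbit_map [IsIsometricSMul G X] (hK : K.IsCAT0)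
    (hcell : ∀ g : G, ∀ C ∈ K.cells, g • C ∈ K.cells)
    [CompactSpace (MulAction.orbitRel.Quotient G X)]
    {d : G → G → ℝ} (hd0 : ∀ g h, 0 ≤ d g h) (hsymm : ∀ g h, d g h = d h g)
    (htri : ∀ g h k, d g k ≤ d g h + d h k) (hmul : ∀ k g h, d (k * g) (k * h) = d g h)
    (hstab : ∀ C ∈ K.cells, ∃ B, ∀ s ∈ MulAction.stabilizer G C, d 1 s ≤ B) (x₀ : X) :
    ∃ (f : X → G) (A B : ℝ), 0 ≤ A ∧ 0 ≤ B ∧ (∀ x y, d (f x) (f y) ≤ A * dist x y + B) ∧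
      (∀ x, dist x (f x • x₀) ≤ B) ∧ ∀ g, d (f (g • x₀)) g ≤ B := by
  have hfin := finite_orbitRep hK hcell
  have hrep : ∀ R ∈ orbitRep G '' K.cells, R ∈ K.cells := by
    rintro _ ⟨C, hC, rfl⟩
    exact orbitRep_mem_cells hcell hC
  obtain ⟨B₁, hB₁0, hB₁⟩ := hfin.exists_uniform_bound (fun R hR => hstab R (hrep R hR))
    (fun R B B' hB h s hs => (h s hs).trans hB)
  obtain ⟨B₂, hB₂0, hB₂⟩ := hfin.exists_uniform_bound
    (p := fun R B => ∀ D ∈ K.cells, D ⊆ R → d 1 (orbitMover G D) ≤ B)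
    (fun R hR => by
      obtain ⟨B, -, hB⟩ := (K.finite_subcells (hrep R hR)).exists_uniform_bound
        (p := fun D B => d 1 (orbitMover G D) ≤ B) (fun D _ => ⟨_, le_rfl⟩)
        (fun D B B' h h' => h'.trans h)
      exact ⟨B, fun D hD hDR => hB D ⟨hD, hDR⟩⟩)
    (fun R B B' hB h D hD hDR => (h D hD hDR).trans hB)
  obtain ⟨B₄, hB₄0, hB₄⟩ := hfin.exists_uniform_bound
    (fun R hR => exists_forall_mem_cell_dist_le hK (hrep R hR) x₀)
    (fun R B B' hB h s hs => (h s hs).trans hB)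
  -- Two elements carrying the representative to `C` differ by an element of the representative's
  -- stabilizer.
  have hmover : ∀ C ∈ K.cells, ∀ g : G, g • orbitRep G C = C → d g (orbitMover G C) ≤ B₁ := by
    intro C hC g hg
    have h1 := hB₁ _ (Set.mem_image_of_mem _ hC) (g⁻¹ * orbitMover G C) (by
      rw [MulAction.mem_stabilizer_iff, mul_smul, orbitMover_smul, inv_smul_eq_iff, hg])
    rwa [← hmul g, mul_one, mul_inv_cancel_left] at h1
  -- Translate `C` back to its representative, where only finitely many subcells occur; `B₁` pays
  -- for the change of mover.
  have hsub : ∀ C ∈ K.cells, ∀ D ∈ K.cells, D ⊆ C →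
      d (orbitMover G C) (orbitMover G D) ≤ B₂ + B₁ := by
    intro C hC D hD hDC
    set a := orbitMover G C with ha
    have hD' : a⁻¹ • D ∈ K.cells := hcell _ _ hD
    have hsub : a⁻¹ • D ⊆ orbitRep G C := by
      rw [Set.smul_set_subset_iff_subset_inv_smul_set, inv_inv, ha, orbitMover_smul]
      exact hDC
    have h1 := hB₂ _ (Set.mem_image_of_mem _ hC) _ hD' hsub
    have h2 := hmover D hD (a * orbitMover G (a⁻¹ • D)) (by
      rw [mul_smul, ← orbitRep_smul a⁻¹ D, orbitMover_smul, smul_inv_smul])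
    rw [← hmul a, mul_one] at h1
    exact (htri _ _ _).trans (add_le_add h1 h2)
  have hcommon : ∀ C ∈ K.cells, ∀ D ∈ K.cells, ∀ E ∈ K.cells, E ⊆ C → E ⊆ D →
      d (orbitMover G C) (orbitMover G D) ≤ 2 * (B₂ + B₁) := by
    intro C hC D hD E hE hEC hED
    have h1 := hsub C hC E hE hEC
    have h2 := hsub D hD E hE hED
    rw [hsymm] at h2
    linarith [htri (orbitMover G C) (orbitMover G E) (orbitMover G D)]
  choose σ hσ hxσ using K.cover
  obtain ⟨ε, hε0, hε⟩ := exists_lebesgue_number (G := G) hK hcell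
  set B₃ := 2 * (B₂ + B₁) with hB₃
  have hB₃0 : 0 ≤ B₃ := by positivity
  have hnear : ∀ y z, dist y z < ε → d (orbitMover G (σ y)) (orbitMover G (σ z)) ≤ B₃ := by
    intro y z hyz
    obtain ⟨E, hE, h1, h2⟩ := hε y z hyz _ (hσ y) _ (hσ z) (hxσ y) (hxσ z)
    exact hcommon _ (hσ y) _ (hσ z) E hE h1 h2
  have hbase := hd0 (orbitMover G (σ x₀)) 1
  refine ⟨fun x => orbitMover G (σ x), B₃ / ε,
    2 * B₃ + B₄ + B₁ + d (orbitMover G (σ x₀)) 1, by positivity, by positivity, ?_, ?_, ?_⟩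
  · intro x y
    obtain ⟨γ, hγ0, hγ1, hγ⟩ := hK.isCAT0Space.1 x y
    set n := ⌊dist x y / ε⌋₊ + 1 with hn
    have hn0 : (0 : ℝ) < n := by positivity
    have hn1 : dist x y / n < ε := by
      have h1 := Nat.lt_floor_add_one (dist x y / ε)
      rw [div_lt_iff₀ hε0] at h1
      rw [div_lt_iff₀ hn0, hn, mul_comm]
      push_cast
      exact h1
    -- The factor is `i + 1` because `d g g = 0` is not among the assumptions, so the start of the
    -- chain already costs `B₃`.
    have hchain : ∀ i : ℕ, i ≤ n →
        d (orbitMover G (σ x)) (orbitMover G (σ (γ (i / n)))) ≤ (i + 1) * B₃ := by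
      intro i
      induction i with
      | zero =>
        intro _
        have := hnear x x (by simpa using hε0)
        simpa [hγ0] using this
      | succ i ih =>
        intro hi
        have h1 := ih (by omega)
        have hmem : ∀ j : ℕ, j ≤ n → (j : ℝ) / n ∈ Set.Icc (0 : ℝ) 1 := fun j hj =>
          ⟨by positivity, (div_le_one hn0).2 (by exact_mod_cast hj)⟩
        have h2 := hγ _ (hmem i (by omega)) _ (hmem (i + 1) hi)
        have h3 : |(i : ℝ) / n - ((i + 1 : ℕ) : ℝ) / n| = 1 / n := by
          rw [← sub_div]
          push_cast
          rw [show (i : ℝ) - (i + 1) = -1 by ring, abs_div, abs_neg, abs_one, abs_of_pos hn0]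
        rw [h3, one_div_mul_eq_div] at h2
        have h4 := hnear _ _ (h2.trans_lt hn1)
        have h5 := htri (orbitMover G (σ x)) (orbitMover G (σ (γ (i / n))))
          (orbitMover G (σ (γ ((i + 1 : ℕ) / n))))
        push_cast at h5 h4 ⊢
        linarith
    have h2 : d (orbitMover G (σ x)) (orbitMover G (σ y)) ≤ (n + 1) * B₃ := by
      have := hchain n le_rfl
      rwa [div_self hn0.ne', hγ1] at this
    have h3 : (n : ℝ) ≤ dist x y / ε + 1 := by
      rw [hn]
      push_cast
      linarith [Nat.floor_le (show 0 ≤ dist x y / ε by positivity)]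
    have h4 : (n + 1) * B₃ ≤ (dist x y / ε + 2) * B₃ :=
      mul_le_mul_of_nonneg_right (by linarith) hB₃0
    have h5 : (dist x y / ε + 2) * B₃ = B₃ / ε * dist x y + 2 * B₃ := by ring
    linarith
  · intro x
    obtain ⟨z, hz, hzx⟩ : x ∈ orbitMover G (σ x) • orbitRep G (σ x) := by
      rw [orbitMover_smul]
      exact hxσ x
    have h1 := hB₄ _ (Set.mem_image_of_mem _ (hσ x)) z hz
    have h2 : dist x (orbitMover G (σ x) • x₀) = dist z x₀ := by
      have h3 : orbitMover G (σ x) • z = x := hzx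
      have h4 := dist_smul (orbitMover G (σ x)) z x₀
      rwa [h3] at h4
    linarith
  · intro g
    have h1 : d (orbitMover G (σ (g • x₀))) (orbitMover G (g • σ x₀)) ≤ B₃ := by
      obtain ⟨E, hE, h1, h2⟩ := hε (g • x₀) (g • x₀) (by simpa using hε0) _ (hσ (g • x₀)) _
        (hcell g _ (hσ x₀)) (hxσ _) (Set.smul_mem_smul_set (hxσ x₀))
      exact hcommon _ (hσ _) _ (hcell g _ (hσ x₀)) E hE h1 h2
    have h2 := hmover _ (hcell g _ (hσ x₀)) (g * orbitMover G (σ x₀)) (by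
      rw [orbitRep_smul, mul_smul, orbitMover_smul])
    rw [hsymm] at h2
    have h3 := hmul g (orbitMover G (σ x₀)) 1
    rw [mul_one] at h3
    linarith [htri (orbitMover G (σ (g • x₀))) (orbitMover G (g • σ x₀)) g,
      htri (orbitMover G (g • σ x₀)) (g * orbitMover G (σ x₀)) g]

end CubeComplex

/-! ### Path metrics of graphs -/

section GraphDist

variable {V : Type*} {Γ : SimpleGraph V}

theorem graphDist_nonneg (u v : V) : 0 ≤ graphDist Γ u v := Nat.cast_nonneg _

theorem graphDist_comm (u v : V) : graphDist Γ u v = graphDist Γ v u := by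
  rw [graphDist, graphDist, SimpleGraph.dist_comm]

theorem graphDist_self (u : V) : graphDist Γ u u = 0 := by
  simp [graphDist]

theorem graphDist_triangle (hΓ : Γ.Connected) (u v w : V) :
    graphDist Γ u w ≤ graphDist Γ u v + graphDist Γ v w := by
  unfold graphDist
  exact_mod_cast hΓ.dist_triangle

theorem graphDist_le_one_of_adj {u v : V} (h : Γ.Adj u v) : graphDist Γ u v ≤ 1 := by
  rw [graphDist, SimpleGraph.dist_eq_one_iff_adj.2 h, Nat.cast_one]

theorem dist_le_mul_graphDist {X : Type*} [MetricSpace X] (hΓ : Γ.Connected) {F : V → X} {M : ℝ}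
    (hF : ∀ u v, Γ.Adj u v → dist (F u) (F v) ≤ M) (u v : V) :
    dist (F u) (F v) ≤ M * graphDist Γ u v := by
  have key : ∀ {u v : V} (p : Γ.Walk u v), dist (F u) (F v) ≤ M * p.length := by
    intro u v p
    induction p with
    | nil => simp
    | @cons a b c h p ih =>
      rw [SimpleGraph.Walk.length_cons]
      push_cast
      linarith [dist_triangle (F a) (F b) (F c), hF a b h]
  obtain ⟨p, hp⟩ := hΓ.exists_walk_length_eq_dist u v
  have := key p
  rwa [hp] at this

end GraphDist

/-! ### Coned-off Cayley graphs -/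

section ConedOff

variable {G : Type*} [Group G] {𝓟 : Set (Subgroup G)} {S : Set G}

/-- Left multiplication on the vertices of the coned-off Cayley graph. -/
def conedOffMul (k : G) : ConedOffVertex 𝓟 → ConedOffVertex 𝓟 :=
  Sum.map (fun g => k * g) (fun c => ⟨c.1, k • c.2⟩)

theorem conedOffMul_inl (k g : G) :
    conedOffMul k (Sum.inl g : ConedOffVertex 𝓟) = Sum.inl (k * g) := rfl

theorem conedOffMul_inv_conedOffMul (k : G) (v : ConedOffVertex 𝓟) :
    conedOffMul k⁻¹ (conedOffMul k v) = v := by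
  rcases v with g | ⟨P, c⟩
  · simp [conedOffMul]
  · simp [conedOffMul]

theorem ConedOffRel.mul {u v : ConedOffVertex 𝓟} (h : ConedOffRel 𝓟 S u v) (k : G) :
    ConedOffRel 𝓟 S (conedOffMul k u) (conedOffMul k v) := by
  cases h with
  | cayley g s hs =>
    simp only [conedOffMul_inl, ← mul_assoc]
    exact .cayley (k * g) s hs
  | cone g P => exact .cone (k * g) P

theorem conedOffCayleyGraph_adj_mul {u v : ConedOffVertex 𝓟}
    (h : (conedOffCayleyGraph 𝓟 S).Adj u v) (k : G) :
    (conedOffCayleyGraph 𝓟 S).Adj (conedOffMul k u) (conedOffMul k v) := by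
  rw [conedOffCayleyGraph, SimpleGraph.fromRel_adj] at h ⊢
  refine ⟨fun hne => h.1 ?_, h.2.imp (fun h => h.mul k) (fun h => h.mul k)⟩
  rw [← conedOffMul_inv_conedOffMul k u, hne, conedOffMul_inv_conedOffMul]

theorem conedOffCayleyGraph_adj_cone (g : G) (P : 𝓟) :
    (conedOffCayleyGraph 𝓟 S).Adj (Sum.inl g) (Sum.inr ⟨P, (g : G ⧸ (P : Subgroup G))⟩) := by
  rw [conedOffCayleyGraph, SimpleGraph.fromRel_adj]
  exact ⟨by simp, Or.inl (.cone g P)⟩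

theorem reachable_conedOffMul {u v : ConedOffVertex 𝓟}
    (h : (conedOffCayleyGraph 𝓟 S).Reachable u v) (k : G) :
    (conedOffCayleyGraph 𝓟 S).Reachable (conedOffMul k u) (conedOffMul k v) :=
  h.map ⟨conedOffMul k, fun h => conedOffCayleyGraph_adj_mul h k⟩

theorem conedOffCayleyGraph_adj_cone_mul (g : G) {P : Subgroup G} (hP : P ∈ 𝓟) {p : G}
    (hp : p ∈ P) : (conedOffCayleyGraph 𝓟 S).Adj (Sum.inl (g * p))
      (Sum.inr ⟨⟨P, hP⟩, (g : G ⧸ P)⟩) := by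
  have h : ((g * p : G) : G ⧸ P) = (g : G ⧸ P) := QuotientGroup.mk_mul_of_mem g hp
  have := conedOffCayleyGraph_adj_cone (S := S) (g * p) (⟨P, hP⟩ : 𝓟)
  simp only [h] at this
  exact this

/-- A generator from `S` is adjacent or equal to 1, and one from some `P` is reached through the
cone vertex of `P`; left translation handles products and inverses. -/
theorem conedOffCayleyGraph_connected (hS : IsFiniteRelGenSet 𝓟 S) :
    (conedOffCayleyGraph 𝓟 S).Connected := by
  have hone : ∀ g : G, (conedOffCayleyGraph 𝓟 S).Reachable (Sum.inl 1) (Sum.inl g) := by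
    intro g
    have hg : g ∈ Subgroup.closure (S ∪ ⋃ P ∈ 𝓟, (P : Set G)) := hS.2 ▸ Subgroup.mem_top g
    induction hg using Subgroup.closure_induction with
    | mem s hs =>
      rcases hs with hs | hs
      · by_cases h1 : s = 1
        · rw [h1]
        · refine SimpleGraph.Adj.reachable ?_
          rw [conedOffCayleyGraph, SimpleGraph.fromRel_adj]
          refine ⟨by simpa using Ne.symm h1, Or.inl ?_⟩
          have := ConedOffRel.cayley (𝓟 := 𝓟) 1 s hs
          rwa [one_mul] at this
      · obtain ⟨P, hP, hs⟩ := Set.mem_iUnion₂.1 hs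
        have h1 := conedOffCayleyGraph_adj_cone (S := S) (1 : G) (⟨P, hP⟩ : 𝓟)
        have h2 := conedOffCayleyGraph_adj_cone_mul (S := S) (1 : G) hP hs
        rw [one_mul] at h2
        exact h1.reachable.trans h2.reachable.symm
    | one => exact .rfl
    | mul g h _ _ ihg ihh =>
      have := reachable_conedOffMul ihh g
      rw [conedOffMul_inl, conedOffMul_inl, mul_one] at this
      exact ihg.trans this
    | inv g _ ih =>
      have := reachable_conedOffMul ih g⁻¹
      rw [conedOffMul_inl, conedOffMul_inl, mul_one, inv_mul_cancel] at this
      exact this.symm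
  have hall : ∀ v, (conedOffCayleyGraph 𝓟 S).Reachable (Sum.inl 1) v := by
    rintro (g | ⟨P, c⟩)
    · exact hone g
    · obtain ⟨g, rfl⟩ := QuotientGroup.mk_surjective c
      exact (hone g).trans (conedOffCayleyGraph_adj_cone g P).reachable
  have : Nonempty (ConedOffVertex 𝓟) := ⟨Sum.inl 1⟩
  exact ⟨fun u v => (hall u).symm.trans (hall v)⟩

theorem graphDist_conedOffMul (hΓ : (conedOffCayleyGraph 𝓟 S).Connected) (k : G)
    (u v : ConedOffVertex 𝓟) :
    graphDist (conedOffCayleyGraph 𝓟 S) (conedOffMul k u) (conedOffMul k v) =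
      graphDist (conedOffCayleyGraph 𝓟 S) u v := by
  have hle : ∀ (k : G) (u v : ConedOffVertex 𝓟),
      (conedOffCayleyGraph 𝓟 S).dist (conedOffMul k u) (conedOffMul k v) ≤
        (conedOffCayleyGraph 𝓟 S).dist u v := by
    intro k u v
    obtain ⟨p, hp⟩ := hΓ.exists_walk_length_eq_dist u v
    let φ : conedOffCayleyGraph 𝓟 S →g conedOffCayleyGraph 𝓟 S :=
      ⟨conedOffMul k, fun h => conedOffCayleyGraph_adj_mul h k⟩
    rw [← hp, ← SimpleGraph.Walk.length_map φ p]
    exact SimpleGraph.dist_le (p.map φ)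
  have h2 := hle k⁻¹ (conedOffMul k u) (conedOffMul k v)
  rw [conedOffMul_inv_conedOffMul, conedOffMul_inv_conedOffMul] at h2
  unfold graphDist
  exact_mod_cast (hle k u v).antisymm h2

theorem graphDist_mul_mem_le (hΓ : (conedOffCayleyGraph 𝓟 S).Connected) (g : G) {P : Subgroup G}
    (hP : P ∈ 𝓟) {p : G} (hp : p ∈ P) :
    graphDist (conedOffCayleyGraph 𝓟 S) (Sum.inl g) (Sum.inl (g * p)) ≤ 2 := by
  have h1 := graphDist_le_one_of_adj (conedOffCayleyGraph_adj_cone (S := S) g (⟨P, hP⟩ : 𝓟))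
  have h2 := graphDist_le_one_of_adj (conedOffCayleyGraph_adj_cone_mul (S := S) g hP hp)
  rw [graphDist_comm] at h2
  linarith [graphDist_triangle hΓ (Sum.inl g) (Sum.inr ⟨⟨P, hP⟩, (g : G ⧸ P)⟩) (Sum.inl (g * p))]

/-- In the infinite case an element is `a * q * a⁻¹` with `q` in some `P`. Travel from 1 through `a`
and `a * q`: the middle jump costs at most 2 via a cone vertex, and the two others do not depend on
`q`. -/
theorem CubeComplex.IsRelativelyGeometric.exists_stabilizer_bound {X : Type*} [MetricSpace X]
    [MulAction G X] [IsIsometricSMul G X] {K : CubeComplex X} (hact : K.IsRelativelyGeometric 𝓟)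
    (hΓ : (conedOffCayleyGraph 𝓟 S).Connected) {C : Set X} (hC : C ∈ K.cells) :
    ∃ B, ∀ s ∈ MulAction.stabilizer G C,
      graphDist (conedOffCayleyGraph 𝓟 S) (Sum.inl 1) (Sum.inl s) ≤ B := by
  rcases hact.stabilizer C hC with hfin | ⟨P, hP, Q, hQP, -, a, ha⟩
  · have hfin' : (MulAction.stabilizer G C : Set G).Finite := Set.toFinite _
    obtain ⟨B, -, hB⟩ := hfin'.exists_uniform_bound
      (p := fun s B => graphDist (conedOffCayleyGraph 𝓟 S) (Sum.inl 1) (Sum.inl s) ≤ B)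
      (fun s _ => ⟨_, le_rfl⟩) (fun _ _ _ h h' => h'.trans h)
    exact ⟨B, hB⟩
  · set d := graphDist (conedOffCayleyGraph 𝓟 S) with hd
    refine ⟨d (Sum.inl 1) (Sum.inl a) + 2 + d (Sum.inl 1) (Sum.inl a⁻¹), fun s hs => ?_⟩
    rw [ha] at hs
    obtain ⟨q, hq, rfl⟩ := Subgroup.mem_smul_pointwise_iff_exists _ _ _ |>.1 hs
    have h1 := graphDist_mul_mem_le hΓ a hP (hQP hq)
    have h2 := graphDist_conedOffMul hΓ (a * q) (Sum.inl 1) (Sum.inl a⁻¹)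
    rw [conedOffMul_inl, conedOffMul_inl, mul_one] at h2
    have h3 : MulAut.conj a • q = a * q * a⁻¹ := rfl
    rw [h3]
    have h4 := graphDist_triangle hΓ (Sum.inl 1) (Sum.inl a) (Sum.inl (a * q * a⁻¹))
    have h5 := graphDist_triangle hΓ (Sum.inl a) (Sum.inl (a * q)) (Sum.inl (a * q * a⁻¹))
    linarith

/-- The orbit map extends to a Lipschitz map on the coned-off Cayley graph if the subgroups in `𝓟`
are elliptic. -/
theorem exists_dist_smul_le_mul_graphDist {X : Type*} [MetricSpace X]
    [MulAction G X] [IsIsometricSMul G X] (h𝓟 : 𝓟.Finite) (hS : IsFiniteRelGenSet 𝓟 S)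
    (hell : ∀ P ∈ 𝓟, ∃ x : X, ∀ g ∈ P, g • x = x) (x₀ : X) :
    ∃ M, 0 ≤ M ∧ ∀ g h : G, dist (g • x₀) (h • x₀) ≤
      M * graphDist (conedOffCayleyGraph 𝓟 S) (Sum.inl g) (Sum.inl h) := by
  have : Nonempty X := ⟨x₀⟩
  choose! c hc using hell
  obtain ⟨M₁, hM₁0, hM₁⟩ := hS.1.exists_uniform_bound
    (p := fun s B => dist x₀ (s • x₀) ≤ B)
    (fun s _ => ⟨_, le_rfl⟩) (fun _ _ _ h h' => h'.trans h)
  obtain ⟨M₂, hM₂0, hM₂⟩ := h𝓟.exists_uniform_bound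
    (p := fun P B => dist x₀ (c P) ≤ B)
    (fun s _ => ⟨_, le_rfl⟩) (fun _ _ _ h h' => h'.trans h)
  -- The choice of coset representative is harmless, since `P` fixes `c P`.
  let F : ConedOffVertex 𝓟 → X := Sum.elim (fun g => g • x₀) (fun v => v.2.out • c v.1)
  have hrel : ∀ u v, ConedOffRel 𝓟 S u v → dist (F u) (F v) ≤ M₁ + M₂ := by
    intro u v h
    cases h with
    | cayley g s hs =>
      have h1 : dist (g • x₀) ((g * s) • x₀) = dist x₀ (s • x₀) := by rw [mul_smul, dist_smul]
      change dist (g • x₀) ((g * s) • x₀) ≤ M₁ + M₂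
      linarith [hM₁ s hs]
    | cone g P =>
      obtain ⟨p, hp⟩ := QuotientGroup.mk_out_eq_mul (P : Subgroup G) g
      have h1 : dist (g • x₀) ((g : G ⧸ (P : Subgroup G)).out • c P) = dist x₀ (c P) := by
        rw [hp, mul_smul, hc P P.2 p p.2, dist_smul]
      change dist (g • x₀) ((g : G ⧸ (P : Subgroup G)).out • c P) ≤ M₁ + M₂
      linarith [hM₂ P P.2]
  refine ⟨M₁ + M₂, by positivity, fun g h => ?_⟩
  refine dist_le_mul_graphDist (F := F) (conedOffCayleyGraph_connected hS) (fun u v huv => ?_)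
    (Sum.inl g) (Sum.inl h)
  rw [conedOffCayleyGraph, SimpleGraph.fromRel_adj] at huv
  rcases huv.2 with h | h
  · exact hrel u v h
  · rw [dist_comm]
    exact hrel v u h

theorem CubeComplex.IsRelativelyGeometric.quasiIsometric {X : Type*} [MetricSpace X] [Nonempty X]
    [MulAction G X] [IsIsometricSMul G X] {K : CubeComplex X} (hK : K.IsCAT0)
    (hact : K.IsRelativelyGeometric 𝓟) (h𝓟 : 𝓟.Finite) (hS : IsFiniteRelGenSet 𝓟 S) :
    QuasiIsometric (dist : X → X → ℝ) (graphDist (conedOffCayleyGraph 𝓟 S)) := by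
  have hΓ := conedOffCayleyGraph_connected hS
  obtain ⟨x₀⟩ := ‹Nonempty X›
  obtain ⟨M, hM0, hM⟩ := exists_dist_smul_le_mul_graphDist h𝓟 hS hact.elliptic x₀
  have := hact.cocompact
  set d := graphDist (conedOffCayleyGraph 𝓟 S) with hd
  obtain ⟨f, A, B, hA, hB, hf, hf₁, hf₂⟩ := exists_coarse_inverse_orbit_map hK hact.cellular
    (d := fun g h => d (Sum.inl g) (Sum.inl h))
    (fun _ _ => graphDist_nonneg _ _) (fun _ _ => graphDist_comm _ _)
    (fun _ _ _ => graphDist_triangle hΓ _ _ _) (fun k g h => graphDist_conedOffMul hΓ k (Sum.inl g) (Sum.inl h))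
    (fun C hC => hact.exists_stabilizer_bound hΓ hC) x₀
  have hK1 : 1 ≤ 1 + A + M := by linarith
  -- `2 * B` covers moving both endpoints to the orbit of `x₀`; the extra 1 is the edge to a cone
  -- vertex in the density claim.
  refine ⟨fun x => Sum.inl (f x), 1 + A + M, 2 * B + 1, hK1, by positivity, fun x y => ⟨?_, ?_⟩, ?_⟩
  · rw [sub_le_iff_le_add, inv_mul_le_iff₀ (by linarith)]
    have h1 := hM (f x) (f y)
    have h2 := hf₁ x
    have h3 := hf₁ y
    rw [dist_comm] at h3
    have h4 := dist_triangle4 x (f x • x₀) (f y • x₀) y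
    have h5 : 0 ≤ d (Sum.inl (f x)) (Sum.inl (f y)) := graphDist_nonneg _ _
    nlinarith [mul_nonneg hA h5, mul_nonneg hA hB, mul_nonneg hM0 hB]
  · have h1 := hf x y
    nlinarith [dist_nonneg (x := x) (y := y), mul_nonneg hM0 (dist_nonneg (x := x) (y := y))]
  · have hinl : ∀ g : G, d (Sum.inl (f (g • x₀))) (Sum.inl g) ≤ B := hf₂
    rintro (g | ⟨P, c⟩)
    · exact ⟨g • x₀, by linarith [hinl g]⟩
    · obtain ⟨g, rfl⟩ := QuotientGroup.mk_surjective c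
      have h1 := graphDist_le_one_of_adj (conedOffCayleyGraph_adj_cone (S := S) g P)
      have h2 := graphDist_triangle hΓ (Sum.inl (f (g • x₀))) (Sum.inl g)
        (Sum.inr ⟨P, (g : G ⧸ (P : Subgroup G))⟩)
      exact ⟨g • x₀, by linarith [hinl g]⟩

end ConedOff

/-! ### Quasi-isometry invariance of hyperbolicity -/

/-- In a hyperbolic space, a point almost between `x` and `y` is almost between `x` and `z` or
almost between `z` and `y`. -/
theorem IsGromovHyperbolic.between_or_between {α : Type*} {d : α → α → ℝ} {δ : ℝ}
    (h : IsGromovHyperbolic d δ) (hd : ∀ x y, d x y = d y x) {x y p : α} {E : ℝ}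
    (hp : d x p + d p y ≤ d x y + E) (z : α) :
    d x p + d p z ≤ d x z + (E + 2 * δ) ∨ d z p + d p y ≤ d z y + (E + 2 * δ) := by
  have h1 := h x y p z
  rcases max_cases (d x p + d y z) (d x z + d y p) with ⟨he, -⟩ | ⟨he, -⟩ <;> rw [he] at h1
  · right
    linarith [hd z p, hd z y]
  · left
    linarith [hd y p]

/-- The hypothesis bounds `D` by a logarithm of a linear function of `D`, which confines `D`. It
will be applied to the distance from a geodesic to a path, with `k` the number of bisections. -/
theorem exists_bound_of_forall_le_two_pow (a b c e : ℝ) (hb : 0 < b) (hc : 0 ≤ c) :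
    ∃ R, ∀ D : ℝ, (∀ k : ℕ, c * D + e ≤ 2 ^ k → D ≤ a + b * k) → D ≤ R := by
  have h0 := tendsto_pow_const_div_const_pow_of_one_lt 0 (one_lt_two (α := ℝ))
  have h1 := tendsto_pow_const_div_const_pow_of_one_lt 1 (one_lt_two (α := ℝ))
  have h2 := (h0.const_mul (c * (a + 2 * b) + e)).add (h1.const_mul (c * b))
  simp only [mul_zero, add_zero] at h2
  obtain ⟨N, hN⟩ := Filter.eventually_atTop.1 (h2.eventually_lt_const one_pos)
  refine ⟨a + b * (N + 1), fun D hD => ?_⟩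
  by_contra! hlt
  set k := ⌊(D - a) / b⌋₊ with hk
  have hpos : (N : ℝ) + 1 < (D - a) / b := by
    rw [lt_div_iff₀ hb]
    linarith
  have hk1 : (k : ℝ) ≤ (D - a) / b :=
    Nat.floor_le (le_trans (by positivity : (0 : ℝ) ≤ (N : ℝ) + 1) hpos.le)
  have hk2 : (D - a) / b < k + 1 := Nat.lt_floor_add_one _
  have hNk : N + 1 ≤ k := Nat.le_floor (by push_cast; exact hpos.le)
  -- For large `D` the exponent `j = k - 1` is still admissible, but it yields a bound on `D`
  -- smaller than `a + b * k ≤ D`.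
  obtain ⟨j, hj⟩ : ∃ j, k = j + 1 := ⟨k - 1, by omega⟩
  have hjk : (k : ℝ) = j + 1 := by exact_mod_cast hj
  have hDj : D ≤ a + 2 * b + b * j := by
    rw [div_lt_iff₀ hb, hjk] at hk2
    linarith
  have hjD := hD j (by
    have h3 := hN j (by omega)
    have h4 : (0 : ℝ) < 2 ^ j := by positivity
    rw [pow_zero, pow_one, mul_one_div, ← mul_div_assoc, ← add_div, div_lt_one h4] at h3
    linarith [mul_le_mul_of_nonneg_left hDj hc])
  rw [le_div_iff₀ hb, hjk] at hk1
  linarith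

/-! ### Hyperbolic graphs: quasi-geodesics and centres of triangles. -/

section Graph

variable {V : Type*} {Γ : SimpleGraph V}

theorem SimpleGraph.Connected.exists_dist_eq (hΓ : Γ.Connected) (u v : V) {n : ℕ}
    (hn : n ≤ Γ.dist u v) : ∃ w, Γ.dist u w = n ∧ n + Γ.dist w v = Γ.dist u v := by
  obtain ⟨p, hp⟩ := hΓ.exists_walk_length_eq_dist u v
  refine ⟨p.getVert n, ?_⟩
  have h1 := SimpleGraph.dist_le (p.take n)
  have h2 := SimpleGraph.dist_le (p.drop n)
  have h3 : (p.take n).length ≤ n := by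
    rw [SimpleGraph.Walk.take_length]
    exact min_le_left _ _
  have h4 : (p.drop n).length = p.length - n := SimpleGraph.Walk.drop_length _ _
  have h5 := hΓ.dist_triangle (u := u) (v := p.getVert n) (w := v)
  omega

/-- Logarithmic divergence: a point almost between two points of a path is close to the path, up to
a constant times the number of bisections of the path needed to get down to length one. -/
theorem IsGromovHyperbolic.exists_near_of_bisection {δ : ℝ}
    (hδ : IsGromovHyperbolic (graphDist Γ) δ) (c : ℝ → V) {L : ℝ}
    {p : V} (k : ℕ) : ∀ {E s t : ℝ}, s ∈ Set.Icc (0 : ℝ) 1 → t ∈ Set.Icc (0 : ℝ) 1 →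
    |s - t| * L ≤ 2 ^ k →
    graphDist Γ (c s) p + graphDist Γ p (c t) ≤ graphDist Γ (c s) (c t) + E →
    ∃ u ∈ Set.Icc (0 : ℝ) 1, ∃ v ∈ Set.Icc (0 : ℝ) 1, |u - v| * L ≤ 1 ∧
      graphDist Γ (c u) p + graphDist Γ p (c v) ≤ graphDist Γ (c u) (c v) + (E + 2 * δ * k) := by
  induction k with
  | zero =>
    intro E s t hs ht hst hp
    exact ⟨s, hs, t, ht, by simpa using hst, by simpa using hp⟩
  | succ k ih =>
    intro E s t hs ht hst hp
    have hm : (s + t) / 2 ∈ Set.Icc (0 : ℝ) 1 :=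
      ⟨by linarith [hs.1, ht.1], by linarith [hs.2, ht.2]⟩
    have h1 : |s - (s + t) / 2| = |s - t| / 2 := by
      rw [show s - (s + t) / 2 = (s - t) / 2 by ring, abs_div, abs_two]
    have h2 : |(s + t) / 2 - t| = |s - t| / 2 := by
      rw [show (s + t) / 2 - t = (s - t) / 2 by ring, abs_div, abs_two]
    rw [pow_succ] at hst
    have h3 : ∀ E', E' = E + 2 * δ + 2 * δ * k → E' = E + 2 * δ * ((k + 1 : ℕ) : ℝ) := by
      intro E' h
      rw [h]
      push_cast
      ring
    rw [← h3 _ rfl]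
    rcases hδ.between_or_between graphDist_comm hp (c ((s + t) / 2)) with h | h
    · exact ih hs hm (by rw [h1]; linarith) h
    · exact ih hm ht (by rw [h2]; linarith) h

/-- Half of the stability of quasi-geodesics: geodesics of a hyperbolic graph stay close to
quasi-geodesics with the same endpoints. -/
theorem IsGromovHyperbolic.exists_geodesic_near_quasigeodesic (hΓ : Γ.Connected) {δ : ℝ}
    (hδ : IsGromovHyperbolic (graphDist Γ) δ) (hδ0 : 0 ≤ δ) {A B : ℝ} (hA : 0 ≤ A) :
    ∃ R, ∀ (c : ℝ → V) (L : ℝ),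
      (∀ s ∈ Set.Icc (0 : ℝ) 1, ∀ t ∈ Set.Icc (0 : ℝ) 1,
        graphDist Γ (c s) (c t) ≤ A * (|s - t| * L) + B ∧
        |s - t| * L ≤ A * (graphDist Γ (c s) (c t) + B)) →
      ∀ p, graphDist Γ (c 0) p + graphDist Γ p (c 1) ≤ graphDist Γ (c 0) (c 1) →
        ∃ t ∈ Set.Icc (0 : ℝ) 1, graphDist Γ p (c t) ≤ R := by
  -- With `D` the largest distance to the path, the subpath to be bisected has parameter length at
  -- most `A * (6 * D + B)`. After `k` bisections `D` is at most `A + B` plus the error `4 * δ + 2 *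
  -- δ * k`; the slope `2 * δ + 1` keeps `b` positive.
  obtain ⟨R, hR⟩ := exists_bound_of_forall_le_two_pow (A + B + 4 * δ) (2 * δ + 1) (6 * A) (A * B)
    (by linarith) (by linarith)
  refine ⟨max R (4 * δ), fun c L hc p₁ hp₁ => ?_⟩
  have h0 : (0 : ℝ) ∈ Set.Icc (0 : ℝ) 1 := by simp
  have h1 : (1 : ℝ) ∈ Set.Icc (0 : ℝ) 1 := by simp
  -- the distance to the path
  have hm : ∀ p : V, ∃ n : ℕ, (∃ t ∈ Set.Icc (0 : ℝ) 1, Γ.dist p (c t) = n) ∧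
      ∀ t ∈ Set.Icc (0 : ℝ) 1, n ≤ Γ.dist p (c t) := by
    intro p
    have hne : {n | ∃ t ∈ Set.Icc (0 : ℝ) 1, Γ.dist p (c t) = n}.Nonempty := ⟨_, 0, h0, rfl⟩
    exact ⟨sInf _, Nat.sInf_mem hne, fun t ht => Nat.sInf_le ⟨t, ht, rfl⟩⟩
  choose m hm₁ hm₂ using hm
  let I : Set V := {p | Γ.dist (c 0) p + Γ.dist p (c 1) ≤ Γ.dist (c 0) (c 1)}
  have hp₁I : p₁ ∈ I := by
    unfold graphDist at hp₁
    exact_mod_cast hp₁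
  have hbdd : BddAbove (m '' I) := by
    refine ⟨Γ.dist (c 0) (c 1), ?_⟩
    rintro _ ⟨p, hp, rfl⟩
    have h2 := hm₂ p 0 h0
    have h3 : Γ.dist (c 0) p + Γ.dist p (c 1) ≤ Γ.dist (c 0) (c 1) := hp
    rw [Γ.dist_comm] at h2
    omega
  -- Among all points on geodesics from `c 0` to `c 1`, take one farthest from the path.
  obtain ⟨p, hpI, hpm⟩ : sSup (m '' I) ∈ m '' I := Nat.sSup_mem ⟨_, p₁, hp₁I, rfl⟩ hbdd
  have hmax : ∀ q ∈ I, m q ≤ m p := fun q hq => by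
    rw [hpm]
    exact le_csSup hbdd ⟨q, hq, rfl⟩
  suffices hD : (m p : ℝ) ≤ max R (4 * δ) by
    obtain ⟨t, ht, hte⟩ := hm₁ p₁
    refine ⟨t, ht, le_trans ?_ hD⟩
    unfold graphDist
    rw [hte]
    exact_mod_cast hmax p₁ hp₁I
  -- on either side of `p`, a point of the geodesic at distance `2 * m p` or an endpoint
  have hside : ∀ τ ∈ Set.Icc (0 : ℝ) 1,
      (∀ q, Γ.dist (c τ) q + Γ.dist q p = Γ.dist (c τ) p → m q ≤ m p) →
      ∃ q, ∃ s ∈ Set.Icc (0 : ℝ) 1, Γ.dist (c τ) q + Γ.dist q p = Γ.dist (c τ) p ∧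
        Γ.dist q p ≤ 2 * m p ∧ Γ.dist q (c s) ≤ m p ∧
        2 * m p + Γ.dist q (c s) ≤ Γ.dist q p + Γ.dist p (c s) := by
    intro τ hτ hq
    by_cases hle : Γ.dist (c τ) p ≤ 2 * m p
    · refine ⟨c τ, τ, hτ, by simp, hle, by simp, ?_⟩
      have h2 := hm₂ p τ hτ
      rw [Γ.dist_self, Γ.dist_comm (u := c τ)]
      omega
    · obtain ⟨q, hq1, hq2⟩ := hΓ.exists_dist_eq (c τ) p (Nat.sub_le (Γ.dist (c τ) p) (2 * m p))
      obtain ⟨s, hs, hse⟩ := hm₁ q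
      have h2 := hq q (by omega)
      have h3 := hm₂ p s hs
      exact ⟨q, s, hs, by omega, by omega, by omega, by omega⟩
  have hpI' : Γ.dist (c 0) p + Γ.dist p (c 1) ≤ Γ.dist (c 0) (c 1) := hpI
  obtain ⟨q, s, hs, hq1, hq2, hq3, hq4⟩ := hside 0 h0 (fun q hq => hmax q (by
    have h2 := hΓ.dist_triangle (u := q) (v := p) (w := c 1)
    change Γ.dist (c 0) q + Γ.dist q (c 1) ≤ Γ.dist (c 0) (c 1)
    omega))
  obtain ⟨q', s', hs', hq1', hq2', hq3', hq4'⟩ := hside 1 h1 (fun q hq => hmax q (by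
    have h2 := hΓ.dist_triangle (u := c 0) (v := p) (w := q)
    change Γ.dist (c 0) q + Γ.dist q (c 1) ≤ Γ.dist (c 0) (c 1)
    rw [Γ.dist_comm (u := c 1), Γ.dist_comm (u := c 1), Γ.dist_comm (u := q) (v := p)] at hq
    omega))
  have hbet : graphDist Γ q p + graphDist Γ p q' ≤ graphDist Γ q q' + 0 := by
    have h2 := hΓ.dist_triangle (u := c 0) (v := q) (w := c 1)
    have h3 := hΓ.dist_triangle (u := q) (v := q') (w := c 1)
    rw [Γ.dist_comm (u := c 1), Γ.dist_comm (u := c 1), Γ.dist_comm (u := q') (v := p)] at hq1'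
    unfold graphDist
    rw [add_zero]
    exact_mod_cast (by omega : Γ.dist q p + Γ.dist p q' ≤ Γ.dist q q')
  have hcast : ∀ {q : V} {s : ℝ}, 2 * m p + Γ.dist q (c s) ≤ Γ.dist q p + Γ.dist p (c s) →
      2 * (m p : ℝ) + graphDist Γ q (c s) ≤ graphDist Γ q p + graphDist Γ p (c s) := by
    intro q s h
    unfold graphDist
    exact_mod_cast h
  -- Replace `q` and `q'` by their projections to the path, at the price of `2 * δ` each. The
  -- alternative puts `p` almost between a point and its projection, which forces `m p` to be small.
  rcases hδ.between_or_between graphDist_comm hbet (c s) with h | h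
  · refine le_max_of_le_right ?_
    linarith [hcast hq4]
  rcases hδ.between_or_between graphDist_comm h (c s') with h | h
  swap
  · refine le_max_of_le_right ?_
    have h2 := hcast hq4'
    linarith [graphDist_comm (Γ := Γ) (c s') p, graphDist_comm (Γ := Γ) p q',
      graphDist_comm (Γ := Γ) (c s') q']
  refine le_max_of_le_left (hR _ fun k hk => ?_)
  have hlen : graphDist Γ (c s) (c s') ≤ 6 * m p := by
    have h2 := hΓ.dist_triangle (u := c s) (v := q) (w := c s')
    have h3 := hΓ.dist_triangle (u := q) (v := p) (w := c s')
    have h4 := hΓ.dist_triangle (u := p) (v := q') (w := c s')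
    rw [Γ.dist_comm (u := c s) (v := q), Γ.dist_comm (u := p) (v := q')] at *
    unfold graphDist
    exact_mod_cast (by omega : Γ.dist (c s) (c s') ≤ 6 * m p)
  have hst : |s - s'| * L ≤ 2 ^ k := by
    refine ((hc s hs s' hs').2.trans ?_).trans hk
    nlinarith
  obtain ⟨u, hu, v, hv, huv, hpuv⟩ := hδ.exists_near_of_bisection c k hs hs' hst h
  have h2 := (hc u hu v hv).1
  have h3 : A * (|u - v| * L) ≤ A := by nlinarith
  have h4 : (m p : ℝ) ≤ graphDist Γ (c u) p := by
    rw [graphDist_comm]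
    unfold graphDist
    exact_mod_cast hm₂ p u hu
  have h5 := graphDist_nonneg (Γ := Γ) p (c v)
  have h6 : (0 : ℝ) ≤ k := Nat.cast_nonneg k
  nlinarith

/-- The centre lies on a geodesic from `x` to `y`, at distance from `x` the Gromov product `g` of
`y` and `z`. The four-point condition controls the other two sides, and rounding `g` down costs at
most 2. -/
theorem IsGromovHyperbolic.exists_center (hΓ : Γ.Connected) {δ : ℝ}
    (hδ : IsGromovHyperbolic (graphDist Γ) δ) (x y z : V) :
    ∃ p, graphDist Γ x p + graphDist Γ p y ≤ graphDist Γ x y + (2 * δ + 2) ∧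
      graphDist Γ x p + graphDist Γ p z ≤ graphDist Γ x z + (2 * δ + 2) ∧
      graphDist Γ y p + graphDist Γ p z ≤ graphDist Γ y z + (2 * δ + 2) := by
  have hδ0 : 0 ≤ δ := by
    have := hδ x x x x
    simp only [graphDist_self, add_zero, max_self] at this
    linarith
  set g := (graphDist Γ x y + graphDist Γ x z - graphDist Γ y z) / 2 with hg
  have hg0 : 0 ≤ g := by
    have := graphDist_triangle hΓ y x z
    rw [graphDist_comm y x] at this
    rw [hg]
    linarith
  have hg1 : g ≤ graphDist Γ x y := by
    have := graphDist_triangle hΓ x y z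
    rw [hg]
    linarith
  obtain ⟨p, hp1, hp2⟩ := hΓ.exists_dist_eq x y (n := ⌊g⌋₊) (Nat.floor_le_of_le hg1)
  have h1 : graphDist Γ x p ≤ g := by
    unfold graphDist
    rw [hp1]
    exact Nat.floor_le hg0
  have h2 : g - 1 ≤ graphDist Γ x p := by
    unfold graphDist
    rw [hp1]
    linarith [Nat.lt_floor_add_one g]
  have h3 : graphDist Γ x p + graphDist Γ p y = graphDist Γ x y := by
    unfold graphDist
    rw [hp1]
    exact_mod_cast hp2
  have h4 := hδ x y p z
  have h5 := graphDist_comm (Γ := Γ) y p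
  refine ⟨p, by linarith, ?_, ?_⟩ <;>
  rcases max_cases (graphDist Γ x p + graphDist Γ y z) (graphDist Γ x z + graphDist Γ y p)
    with ⟨he, -⟩ | ⟨he, -⟩ <;> rw [he] at h4 <;> linarith

end Graph

/-- A geodesic space which is quasi-isometric to a hyperbolic graph is hyperbolic. -/
theorem IsGromovHyperbolic.of_quasiIsometric {X V : Type*} [MetricSpace X] {Γ : SimpleGraph V}
    (hX : ∀ x y : X, ∃ γ : ℝ → X, IsGeodesicFromTo γ x y) (hΓ : Γ.Connected) {δ : ℝ}
    (hδ : IsGromovHyperbolic (graphDist Γ) δ)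
    (hqi : QuasiIsometric (dist : X → X → ℝ) (graphDist Γ)) :
    ∃ δ' : ℝ, IsGromovHyperbolic (dist : X → X → ℝ) δ' := by
  obtain ⟨f, A, B, hA, hB, hf, hdense⟩ := hqi
  have hδ0 : 0 ≤ δ := by
    obtain ⟨v⟩ := hΓ.nonempty
    have := hδ v v v v
    simp only [graphDist_self, add_zero, max_self] at this
    linarith
  have hA0 : 0 < A := by linarith
  have hlow : ∀ x y, dist x y ≤ A * (graphDist Γ (f x) (f y) + B) := by
    intro x y
    have := (hf x y).1
    rwa [sub_le_iff_le_add, inv_mul_le_iff₀ hA0] at this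
  obtain ⟨R, hR⟩ := hδ.exists_geodesic_near_quasigeodesic hΓ hδ0 hA0.le
  -- Such an `f u` is close to a point `p` of a graph geodesic, and `p` is close to the image of a
  -- geodesic of `X`; the lower quasi-isometry bound then puts `u` near that geodesic.
  have hnear : ∀ E, ∃ R', ∀ x y u : X,
      graphDist Γ (f x) (f u) + graphDist Γ (f u) (f y) ≤ graphDist Γ (f x) (f y) + E →
      dist x u + dist u y ≤ dist x y + R' := by
    intro E
    refine ⟨2 * (A * (R + (E + 2 * δ) + B)), fun x y u hu => ?_⟩
    obtain ⟨p, hp1, hp2⟩ := hΓ.exists_dist_eq (f x) (f y)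
      (Nat.min_le_right (Γ.dist (f x) (f u)) (Γ.dist (f x) (f y)))
    have hp3 : graphDist Γ (f x) p + graphDist Γ p (f y) = graphDist Γ (f x) (f y) := by
      unfold graphDist
      rw [hp1]
      exact_mod_cast hp2
    have hp4 : graphDist Γ (f x) p ≤ graphDist Γ (f x) (f u) := by
      unfold graphDist
      rw [hp1]
      exact_mod_cast Nat.min_le_left _ _
    have hpu : graphDist Γ p (f u) ≤ E + 2 * δ := by
      have h1 := hδ (f x) (f y) p (f u)
      have h2 : graphDist Γ (f x) p = graphDist Γ (f x) (f u) ∨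
          graphDist Γ (f x) p = graphDist Γ (f x) (f y) := by
        unfold graphDist
        rw [hp1]
        rcases min_choice (Γ.dist (f x) (f u)) (Γ.dist (f x) (f y)) with h | h <;> simp [h]
      have h3 := graphDist_comm (Γ := Γ) (f y) (f u)
      have h4 := graphDist_comm (Γ := Γ) (f y) p
      have h5 := graphDist_triangle hΓ (f x) (f u) (f y)
      have h6 := graphDist_nonneg (Γ := Γ) p (f y)
      have h7 := graphDist_nonneg (Γ := Γ) (f u) (f y)
      rcases max_cases (graphDist Γ (f x) p + graphDist Γ (f y) (f u))
        (graphDist Γ (f x) (f u) + graphDist Γ (f y) p) with ⟨he, -⟩ | ⟨he, -⟩ <;>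
        rw [he] at h1 <;> rcases h2 with h2 | h2 <;> linarith
    obtain ⟨γ, hγ0, hγ1, hγ⟩ := hX x y
    obtain ⟨t, ht, htR⟩ := hR (fun t => f (γ t)) (dist x y) (fun s hs t ht => by
      rw [← hγ s hs t ht]
      exact ⟨(hf _ _).2, hlow _ _⟩) p (by rw [hγ0, hγ1]; exact hp3.le)
    have h1 : dist (γ t) u ≤ A * (R + (E + 2 * δ) + B) := by
      refine (hlow _ _).trans (mul_le_mul_of_nonneg_left ?_ hA0.le)
      have := graphDist_triangle hΓ (f (γ t)) p (f u)
      rw [graphDist_comm (f (γ t)) p] at this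
      linarith
    have h2 := hγ 0 (by simp) t ht
    have h3 := hγ t ht 1 (by simp)
    rw [hγ0, zero_sub, abs_neg, abs_of_nonneg ht.1] at h2
    rw [hγ1, abs_sub_comm, abs_of_nonneg (sub_nonneg.2 ht.2)] at h3
    have h4 := dist_triangle x (γ t) u
    have h5 := dist_triangle u (γ t) y
    rw [dist_comm u (γ t)] at h5
    linarith
  -- `2 * δ + 2` is the error of the centre, `2 * B` the cost of replacing it by a point `f u`, and
  -- the last `2 * δ` comes from bringing in the fourth point `w`.
  obtain ⟨R', hR'⟩ := hnear (2 * δ + 2 + 2 * B + 2 * δ)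
  refine ⟨R', fun x y z w => ?_⟩
  obtain ⟨p, hxy, hxz, hyz⟩ := hδ.exists_center hΓ (f x) (f y) (f z)
  obtain ⟨u, hu⟩ := hdense p
  have hclose : ∀ a b, graphDist Γ a p + graphDist Γ p b ≤ graphDist Γ a b + (2 * δ + 2) →
      graphDist Γ a (f u) + graphDist Γ (f u) b ≤ graphDist Γ a b + (2 * δ + 2 + 2 * B) := by
    intro a b h
    have h1 := graphDist_triangle hΓ a p (f u)
    have h2 := graphDist_triangle hΓ (f u) p b
    rw [graphDist_comm p (f u)] at h1
    linarith
  have hxz' := hR' x z u (by linarith [hclose _ _ hxz])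
  have hyz' := hR' y z u (by linarith [hclose _ _ hyz])
  have h1 := dist_triangle x u y
  have h2 := dist_triangle z u w
  have h3 := dist_comm z u
  have h4 := dist_comm y u
  -- Bound the left-hand distances by paths through `u` and regroup: `u` is almost between the two
  -- points of each pair in one of the other two pairings.
  rcases hδ.between_or_between graphDist_comm (hclose _ _ hxy) (f w) with h | h
  · have h5 := hR' x w u h
    linarith [le_max_right (dist x z + dist y w) (dist x w + dist y z)]
  · have h5 := hR' w y u h
    linarith [le_max_left (dist x z + dist y w) (dist x w + dist y z), dist_comm w u,
      dist_comm w y]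

/-! ### The proposition. -/

theorem propositionp {G X : Type*} [Group G] (𝓟 : Set (Subgroup G))
    (hG : IsRelativelyHyperbolic 𝓟)
    [MetricSpace X] [Nonempty X] (K : CubeComplex X) (hK : K.IsCAT0)
    [MulAction G X] [IsIsometricSMul G X] (hact : K.IsRelativelyGeometric 𝓟) :
    (∀ S : Set G, IsFiniteRelGenSet 𝓟 S →
      QuasiIsometric (dist : X → X → ℝ) (graphDist (conedOffCayleyGraph 𝓟 S))) ∧
    ∃ δ : ℝ, IsGromovHyperbolic (dist : X → X → ℝ) δ := by
  have hX : ∀ S : Set G, IsFiniteRelGenSet 𝓟 S →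
      QuasiIsometric (dist : X → X → ℝ) (graphDist (conedOffCayleyGraph 𝓟 S)) :=
    fun S hS => hact.quasiIsometric hK hG.1 hS
  obtain ⟨-, S, hS, ⟨δ, hδ⟩, -⟩ := hG
  exact ⟨hX, hδ.of_quasiIsometric hK.isCAT0Space.1 (conedOffCayleyGraph_connected hS) (hX S hS)⟩
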